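/- **Setting.** Messages are Dolev–Yao terms over names, texts, random nonces, string constants, asymmetric key pairs, and a Diffie–Hellman (DH) group: exponents form the free abelian group on a countable set of basic exponents, and $g^e$ is the group element with exponent $e$. Compound terms are formed by pairing, encryption or signature $\{m\}_k$, and an injective one-way $\mathrm{hash}$. A strand is a finite sequence of sends and receptions. The strand space of a model contains infinitely many copies of every instance of four roles — client-reg, server-reg, client-auth, server-auth — and of all penetrator strands (create atoms, copy, discard, pair, separate, encrypt, decrypt, hash, exponentiate, multiply and invert exponents). A bundle is a finite, acyclic, downward-closed set of nodes of strands in which each received message comes by a unique edge from a node of another strand that sends it. The $\mathcal B$-height of a strand is the number of its nodes in the bundle $\mathcal B$. A role has height 6 over TLS 1.2 and 5 over TLS 1.3, the number of messages that it sends or receives. **Protocols.** Each role first runs a TLS handshake (TLS 1.2 with ephemeral DH key exchange, or TLS 1.3) in which only the server is authenticated. The server presents $\mathrm{Cert}=\{server,spk\}_{\mathrm{priv}(ca)}$ and signs its DH value with the private key matching $spk$; in TLS 1.3 it signs the whole transcript. Both parties send finished messages over the transcript. The nonces are $cr$ (client) and $sr$ (server), the DH exponents are $x$ (client) and $y$ (server),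 and the write keys $cwk$, $swk$ are derived from the master secret $ms$, which is a hash of $g^{xy}$ (and, in TLS 1.2, of $cr,sr$). Then UAF registration (the reg roles) is 1. server $\to$ client: $\{username, appid, challenge\}_{swk}$; 2. client $\to$ server: $\{h, aaid, K_{pub}, fc, s\}_{cwk}$, where $h=\mathrm{hash}(K_{priv},username)$, $fc=\mathrm{hash}(appid,challenge,tlsData)$ and $s=\{aaid,fc,K_{pub}\}_A$, with $A$ the attestation private key of the authenticator $aaid$. UAF authentication (the auth roles) is 1. server $\to$ client: $\{appid, challenge\}_{swk}$; 2. client $\to$ server: $\{fc, n, \{fc,n\}_{K_{priv}}\}_{cwk}$, with $n$ a nonce. The three models are - UAF-Endpoint-TLS1.2-DH, with $tlsData=\mathrm{hash}(\text{“uaf\_server\_endpoint”},challenge,\mathrm{hash}(\mathrm{Cert}))$; - UAF-ServerCert-TLS1.2-DH, with $tlsData=\mathrm{hash}(\text{“uaf\_server\_cert”},challenge,\mathrm{Cert})$; - UAF-Exporter-TLS1.3, with $tlsData=\mathrm{hash}(ms,label,cr,sr,ctx)$, where $label$ and $ctx$ are fixed constants. In all bundles considered, every role instance uniquely generates its own DH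 exponent, which is a basic exponent: once that exponent appears on the instance's part of the bundle, it first appears in a message sent by this instance, and no other strand of the bundle generates it. The exponent of the DH value that an instance receives is arbitrary. **Server assumptions** $Orig$ for a server-reg strand $S$ in a bundle. The private keys of $ca$, of the server (matching $spk$), of the attesting authenticator ($A$), and the registered $K_{priv}$ are carried in no message of the bundle. The values $sr$, $challenge$ and $username$ originate in the bundle at exactly one node, which lies on $S$. The exponent $y$ is generated in the bundle at exactly one node, which lies on $S$. **Session context** $Ctx$. Two strands agree on $server$, $ca$, $cr$, $sr$, $x$, $y$, $challenge$, $username$, $appid$ (both strands have these variables, with equal values). Two strands are complementary if one is a client and the other a server. **Goal (session context agreement)** between roles $R_a$ and $R_b$: with $i=height(R_a)$ there is $j\le height(R_b)$ such that $Succ(R_a,R_b,i,j)$ and $Uniq(R_a,i,j)$. Here $Succ(R_a,R_b,i,j)$ means: for every bundle $\mathcal B$ and every strand $s$ of role $R_a$ in $\mathcal B$, of $\mathcal B$-height at least $i$ and satisfying $Orig$, there is a complementary strand $s'$ of role $R_b$ in $\mathcal B$, of $\mathcal B$-height at least $j$, such that $s,s'$ satisfy $Ctx$. And $Uniq(R_a,i,j)$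 means: for all roles $R_b,R_c$, if $Succ(R_a,R_b,i,j)$ and $Succ(R_a,R_c,i,j)$, then $R_b=R_c$. **Theorem.** In each of the strand spaces UAF-Endpoint-TLS1.2-DH, UAF-ServerCert-TLS1.2-DH and UAF-Exporter-TLS1.3, session context agreement holds between server-reg and client-reg under the server assumptions. Moreover, the ideal execution with an honest client is the only shape: - there is a bundle that satisfies the server assumptions and consists of one complete server-reg strand and one complete client-reg strand that agree on $Ctx$ and receive exactly the messages that the other one sends; and - in every bundle, for every complete server-reg strand $s$ that satisfies the server assumptions, there is a complete client-reg strand $s'$ that agrees with $s$ on $Ctx$ and whose trace is that of $s$ with sends and receptions exchanged, and no strand other than $s$ and $s'$ completes a run of any role and agrees with $s$ on $Ctx$. -/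

import Mathlib

namespace UAF

/-! ## Messages (order-sorted Dolev-Yao terms with a Diffie-Hellman algebra)

Names, texts, TLS randoms and basic exponents are four disjoint countable sorts, each indexed
by natural numbers. -/

/-- The string constants that occur in protocol messages. -/
inductive Tag
  | masterSecret
  | handshakeSecret
  | clientHandshakeKey
  | serverHandshakeKey
  | clientWriteKey
  | serverWriteKey
  | clientFinished
  | serverFinished
  | certificateVerify
  | uafServerEndpoint
  | uafServerCert
  | exporterChannelBinding
  | emptyContext

/-- Asymmetric key pairs: the long-term pair of a named party, or a further pair. -/
inductive KeyPair
  | ofName (n : ℕ)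
  | other (k : ℕ)

/-- Diffie-Hellman exponents: the free abelian group on the basic exponents, written additively
(so `x + y` is the product of the exponents `x` and `y`). -/
abbrev Expt := ℕ →₀ ℤ

/-- The basic exponent with index `a`. -/
noncomputable def basicExpt (a : ℕ) : Expt := Finsupp.single a 1

inductive Msg
  | tag (t : Tag)
  | name (n : ℕ)
  | text (n : ℕ)
  | rand (n : ℕ)
  | pub (k : KeyPair)
  | priv (k : KeyPair)
  | expt (e : Expt)
  /-- the group element `g ^ e` -/
  | gexp (e : Expt)
  | pair (a b : Msg)
  /-- `enc m k` is `{m}_k`; it is a signature if `k` is a private key, and a symmetric encryption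
  if `k` is not an asymmetric key -/
  | enc (m k : Msg)
  | hash (m : Msg)

infixr:67 " ⋄ " => Msg.pair

/-- The key that opens an encryption made with the given key. -/
def Msg.inv : Msg → Msg
  | .pub k => .priv k
  | .priv k => .pub k
  | m => m

/-- `Carries t m`: `t` is carried by `m`, i.e. it occurs in `m` outside of keys of encryptions and
outside of hashes. -/
inductive Carries (t : Msg) : Msg → Prop
  | refl : Carries t t
  | left {a b : Msg} : Carries t a → Carries t (Msg.pair a b)
  | right {a b : Msg} : Carries t b → Carries t (Msg.pair a b)
  | body {m k : Msg} : Carries t m → Carries t (Msg.enc m k)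

/-- The basic exponent `a` appears in a message, at any position (also in keys and in hashes). -/
def ExptAppears (a : ℕ) : Msg → Prop
  | .expt e => a ∈ e.support
  | .gexp e => a ∈ e.support
  | .pair m m' => ExptAppears a m ∨ ExptAppears a m'
  | .enc m k => ExptAppears a m ∨ ExptAppears a k
  | .hash m => ExptAppears a m
  | _ => False

/-! ## The three UAF models and their roles -/

inductive Model
  | endpointTLS12DH
  | serverCertTLS12DH
  | exporterTLS13

inductive Side
  | client
  | server

inductive Sign
  | send
  | recv

def Sign.flip : Sign → Sign
  | .send => .recv
  | .recv => .send

/-- The action of the party `me` on a message that is sent by the party `sender`. -/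
def Side.sign : (me sender : Side) → Sign
  | .client, .client => .send
  | .server, .server => .send
  | _, _ => .recv

/-- The values of a TLS session with Diffie-Hellman key exchange. -/
structure TLSSession where
  server : ℕ
  ca : ℕ
  /-- the key pair that the certificate binds to the server -/
  spk : KeyPair
  cr : ℕ
  sr : ℕ
  /-- the client's exponent -/
  x : Expt
  /-- the server's exponent -/
  y : Expt

/-- The TLS variables of one role instance: its own secret exponent is a basic exponent; the
exponent of the public value that it receives is arbitrary. -/
structure TLSVars where
  server : ℕ
  ca : ℕ
  spk : KeyPair
  cr : ℕ
  sr : ℕ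
  ownExp : ℕ
  peerExp : Expt

noncomputable def TLSVars.session (t : TLSVars) : Side → TLSSession
  | .client => ⟨t.server, t.ca, t.spk, t.cr, t.sr, basicExpt t.ownExp, t.peerExp⟩
  | .server => ⟨t.server, t.ca, t.spk, t.cr, t.sr, t.peerExp, basicExpt t.ownExp⟩

structure RegVars where
  username : ℕ
  appid : ℕ
  /-- the authenticator's name -/
  aaid : ℕ
  challenge : ℕ
  /-- the new authentication key pair `(K_pub, K_priv)` -/
  authk : KeyPair

structure AuthVars where
  appid : ℕ
  challenge : ℕ
  nonce : ℕ
  authk : KeyPair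

namespace TLSSession

open Msg

/-- The server's certificate, signed by the certificate authority. -/
def certificate (t : TLSSession) : Msg :=
  enc (name t.server ⋄ pub t.spk) (priv (KeyPair.ofName t.ca))

/-- The Diffie-Hellman shared secret `g ^ (x y)`. -/
noncomputable def sharedSecret (t : TLSSession) : Msg := gexp (t.x + t.y)

/-! ### TLS 1.2 with ephemeral Diffie-Hellman -/

/-- Server hello, certificate, and signed server key exchange. -/
def serverFlight12 (t : TLSSession) : Msg :=
  rand t.sr ⋄ t.certificate ⋄ gexp t.y ⋄
    enc (rand t.cr ⋄ rand t.sr ⋄ gexp t.y) (priv t.spk)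

noncomputable def masterSecret12 (t : TLSSession) : Msg :=
  hash (tag .masterSecret ⋄ t.sharedSecret ⋄ rand t.cr ⋄ rand t.sr)

noncomputable def cwk12 (t : TLSSession) : Msg :=
  hash (tag .clientWriteKey ⋄ t.masterSecret12 ⋄ rand t.sr ⋄ rand t.cr)

noncomputable def swk12 (t : TLSSession) : Msg :=
  hash (tag .serverWriteKey ⋄ t.masterSecret12 ⋄ rand t.sr ⋄ rand t.cr)

noncomputable def clientFinished12 (t : TLSSession) : Msg :=
  hash (tag .clientFinished ⋄ t.masterSecret12 ⋄
    hash (rand t.cr ⋄ t.serverFlight12 ⋄ gexp t.x))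

noncomputable def serverFinished12 (t : TLSSession) : Msg :=
  hash (tag .serverFinished ⋄ t.masterSecret12 ⋄
    hash (rand t.cr ⋄ t.serverFlight12 ⋄ gexp t.x ⋄ t.clientFinished12))

noncomputable def flow12 (t : TLSSession) : List (Side × Msg) :=
  [(.client, rand t.cr),
   (.server, t.serverFlight12),
   (.client, gexp t.x ⋄ enc t.clientFinished12 t.cwk12),
   (.server, enc t.serverFinished12 t.swk12)]

/-! ### TLS 1.3 -/

/-- Client hello and server hello. -/
def hellos13 (t : TLSSession) : Msg :=
  (rand t.cr ⋄ gexp t.x) ⋄ (rand t.sr ⋄ gexp t.y)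

noncomputable def handshakeSecret13 (t : TLSSession) : Msg :=
  hash (tag .handshakeSecret ⋄ t.sharedSecret)

noncomputable def clientHandshakeKey13 (t : TLSSession) : Msg :=
  hash (tag .clientHandshakeKey ⋄ t.handshakeSecret13 ⋄ hash t.hellos13)

noncomputable def serverHandshakeKey13 (t : TLSSession) : Msg :=
  hash (tag .serverHandshakeKey ⋄ t.handshakeSecret13 ⋄ hash t.hellos13)

/-- The server's signature of the transcript. -/
def certificateVerify13 (t : TLSSession) : Msg :=
  enc (tag .certificateVerify ⋄ hash (t.hellos13 ⋄ t.certificate)) (priv t.spk)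

noncomputable def serverFinished13 (t : TLSSession) : Msg :=
  hash (tag .serverFinished ⋄ t.serverHandshakeKey13 ⋄
    hash (t.hellos13 ⋄ t.certificate ⋄ t.certificateVerify13))

/-- The hash of the transcript up to the server's finished message. -/
noncomputable def transcriptHash13 (t : TLSSession) : Msg :=
  hash (t.hellos13 ⋄ t.certificate ⋄ t.certificateVerify13 ⋄ t.serverFinished13)

noncomputable def clientFinished13 (t : TLSSession) : Msg :=
  hash (tag .clientFinished ⋄ t.clientHandshakeKey13 ⋄ t.transcriptHash13)

noncomputable def masterSecret13 (t : TLSSession) : Msg :=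
  hash (tag .masterSecret ⋄ t.handshakeSecret13)

noncomputable def cwk13 (t : TLSSession) : Msg :=
  hash (tag .clientWriteKey ⋄ t.masterSecret13 ⋄ t.transcriptHash13)

noncomputable def swk13 (t : TLSSession) : Msg :=
  hash (tag .serverWriteKey ⋄ t.masterSecret13 ⋄ t.transcriptHash13)

noncomputable def flow13 (t : TLSSession) : List (Side × Msg) :=
  [(.client, rand t.cr ⋄ gexp t.x),
   (.server, (rand t.sr ⋄ gexp t.y) ⋄
      enc (t.certificate ⋄ t.certificateVerify13 ⋄ t.serverFinished13) t.serverHandshakeKey13),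
   (.client, enc t.clientFinished13 t.clientHandshakeKey13)]

end TLSSession

namespace Model

open Msg

/-- The messages of the TLS handshake, each with its sender. -/
noncomputable def tlsFlow : Model → TLSSession → List (Side × Msg)
  | .endpointTLS12DH, t => t.flow12
  | .serverCertTLS12DH, t => t.flow12
  | .exporterTLS13, t => t.flow13

/-- The client write key. -/
noncomputable def cwk : Model → TLSSession → Msg
  | .endpointTLS12DH, t => t.cwk12
  | .serverCertTLS12DH, t => t.cwk12
  | .exporterTLS13, t => t.cwk13

/-- The server write key. -/
noncomputable def swk : Model → TLSSession → Msg
  | .endpointTLS12DH, t => t.swk12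
  | .serverCertTLS12DH, t => t.swk12
  | .exporterTLS13, t => t.swk13

/-- The channel binding. -/
noncomputable def tlsData : Model → TLSSession → (challenge : ℕ) → Msg
  | .endpointTLS12DH, t, c => hash (tag .uafServerEndpoint ⋄ text c ⋄ hash t.certificate)
  | .serverCertTLS12DH, t, c => hash (tag .uafServerCert ⋄ text c ⋄ t.certificate)
  | .exporterTLS13, t, _ =>
      hash (t.masterSecret13 ⋄ tag .exporterChannelBinding ⋄ rand t.cr ⋄ rand t.sr ⋄
        tag .emptyContext)

/-- The final challenge `fc`. -/
noncomputable def finalChallenge (M : Model) (t : TLSSession) (appid challenge : ℕ) : Msg :=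
  hash (name appid ⋄ text challenge ⋄ M.tlsData t challenge)

/-- The registration assertion, signed with the authenticator's attestation key. -/
noncomputable def regAssertion (M : Model) (t : TLSSession) (v : RegVars) : Msg :=
  enc (name v.aaid ⋄ M.finalChallenge t v.appid v.challenge ⋄ pub v.authk)
    (priv (KeyPair.ofName v.aaid))

/-- Registration over TLS. -/
noncomputable def regFlow (M : Model) (t : TLSSession) (v : RegVars) : List (Side × Msg) :=
  M.tlsFlow t ++
  [(.server, enc (name v.username ⋄ name v.appid ⋄ text v.challenge) (M.swk t)),
   (.client, enc (hash (priv v.authk ⋄ name v.username) ⋄ name v.aaid ⋄ pub v.authk ⋄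
      M.finalChallenge t v.appid v.challenge ⋄ M.regAssertion t v) (M.cwk t))]

/-- The authentication assertion, signed with the authentication key. -/
noncomputable def authAssertion (M : Model) (t : TLSSession) (v : AuthVars) : Msg :=
  enc (M.finalChallenge t v.appid v.challenge ⋄ text v.nonce) (priv v.authk)

/-- Authentication over TLS. -/
noncomputable def authFlow (M : Model) (t : TLSSession) (v : AuthVars) : List (Side × Msg) :=
  M.tlsFlow t ++
  [(.server, enc (name v.appid ⋄ text v.challenge) (M.swk t)),
   (.client, enc (M.finalChallenge t v.appid v.challenge ⋄ text v.nonce ⋄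
      M.authAssertion t v) (M.cwk t))]

end Model

inductive Role
  | clientReg
  | serverReg
  | clientAuth
  | serverAuth

def Role.side : Role → Side
  | .clientReg => .client
  | .serverReg => .server
  | .clientAuth => .client
  | .serverAuth => .server

/-- An instance of one of the four roles. -/
inductive Instance
  | reg (side : Side) (t : TLSVars) (v : RegVars)
  | auth (side : Side) (t : TLSVars) (v : AuthVars)

namespace Instance

def role : Instance → Role
  | .reg .client _ _ => .clientReg
  | .reg .server _ _ => .serverReg
  | .auth .client _ _ => .clientAuth
  | .auth .server _ _ => .serverAuth

/-- The index of the secret basic exponent that the instance generates. -/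
def ownExp : Instance → ℕ
  | .reg _ t _ => t.ownExp
  | .auth _ t _ => t.ownExp

noncomputable def trace (M : Model) : Instance → List (Sign × Msg)
  | .reg side t v => (M.regFlow (t.session side) v).map fun e => (side.sign e.1, e.2)
  | .auth side t v => (M.authFlow (t.session side) v).map fun e => (side.sign e.1, e.2)

end Instance

/-- The number of nodes of a fully executing strand of the role. -/
def Role.height (M : Model) : Role → ℕ := fun _ =>
  match M with
  | .endpointTLS12DH => 6
  | .serverCertTLS12DH => 6
  | .exporterTLS13 => 5

theorem Instance.length_trace (M : Model) (a : Instance) :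
    (a.trace M).length = a.role.height M := by
  cases M <;> cases a <;>
    simp [Instance.trace, Role.height, Model.regFlow, Model.authFlow, Model.tlsFlow,
      TLSSession.flow12, TLSSession.flow13]

/-! ## The penetrator -/

/-- What the penetrator can create by itself: constants, names, texts, randoms, keys, basic
exponents, and the group generator. -/
def Msg.Basic : Msg → Prop
  | .pair _ _ => False
  | .enc _ _ => False
  | .hash _ => False
  | .expt e => ∃ a, e = basicExpt a
  | .gexp e => e = 0
  | _ => True

inductive Penetrator
  | create (m : Msg) (h : m.Basic)
  | flush (m : Msg)
  | tee (m : Msg)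
  | concat (a b : Msg)
  | separate (a b : Msg)
  | encrypt (m k : Msg)
  | decrypt (m k : Msg)
  | hash (m : Msg)
  /-- raise a group element to a known exponent -/
  | power (e e' : Expt)
  /-- multiply two known exponents -/
  | mul (e e' : Expt)
  /-- invert a known exponent -/
  | inv (e : Expt)

noncomputable def Penetrator.trace : Penetrator → List (Sign × Msg)
  | .create m _ => [(.send, m)]
  | .flush m => [(.recv, m)]
  | .tee m => [(.recv, m), (.send, m), (.send, m)]
  | .concat a b => [(.recv, a), (.recv, b), (.send, a ⋄ b)]
  | .separate a b => [(.recv, a ⋄ b), (.send, a), (.send, b)]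
  | .encrypt m k => [(.recv, k), (.recv, m), (.send, .enc m k)]
  | .decrypt m k => [(.recv, k.inv), (.recv, .enc m k), (.send, m)]
  | .hash m => [(.recv, m), (.send, .hash m)]
  | .power e e' => [(.recv, .gexp e), (.recv, .expt e'), (.send, .gexp (e + e'))]
  | .mul e e' => [(.recv, .expt e), (.recv, .expt e'), (.send, .expt (e + e'))]
  | .inv e => [(.recv, .expt e), (.send, .expt (-e))]

/-! ## The strand space and its bundles -/

inductive StrandKind
  | honest (a : Instance)
  | penetrator (p : Penetrator)

/-- The strand space: infinitely many copies of every role instance and every penetrator strand. -/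
structure Strand where
  copy : ℕ
  kind : StrandKind

noncomputable def Strand.trace (M : Model) (s : Strand) : List (Sign × Msg) :=
  match s.kind with
  | .honest a => a.trace M
  | .penetrator p => p.trace

/-- `(s, i)` is the `i`-th node of the strand `s`, counted from `0`. -/
abbrev Node := Strand × ℕ

def Sends (M : Model) (n : Node) (m : Msg) : Prop :=
  (n.1.trace M)[n.2]? = some (Sign.send, m)

def Receives (M : Model) (n : Node) (m : Msg) : Prop :=
  (n.1.trace M)[n.2]? = some (Sign.recv, m)

/-- `m` is the message that is sent or received at the node `n`. -/
def HasMsg (M : Model) (n : Node) (m : Msg) : Prop :=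
  Sends M n m ∨ Receives M n m

structure Bundle (M : Model) where
  nodes : Set Node
  /-- the communication edges -/
  edge : Node → Node → Prop
  finite : nodes.Finite
  valid : ∀ n ∈ nodes, n.2 < (n.1.trace M).length
  down_closed : ∀ (s : Strand) (i : ℕ), (s, i + 1) ∈ nodes → (s, i) ∈ nodes
  edge_spec : ∀ n n' : Node, edge n n' →
    n ∈ nodes ∧ n' ∈ nodes ∧ n.1 ≠ n'.1 ∧ ∃ m, Sends M n m ∧ Receives M n' m
  recv_unique : ∀ n' ∈ nodes, ∀ m, Receives M n' m → ∃! n, edge n n'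
  acyclic : ∀ n : Node, ¬ Relation.TransGen
    (fun a b : Node => edge a b ∨ (a ∈ nodes ∧ b ∈ nodes ∧ b.1 = a.1 ∧ b.2 = a.2 + 1)) n n

namespace Bundle

variable {M : Model}

def Contains (B : Bundle M) (s : Strand) : Prop := ∃ i, (s, i) ∈ B.nodes

/-- The number of nodes of the strand in the bundle. -/
noncomputable def height (B : Bundle M) (s : Strand) : ℕ := {i : ℕ | (s, i) ∈ B.nodes}.ncard

end Bundle

/-! ## Origination -/

/-- `t` originates at `n`: it is sent there, and no earlier node of the strand carries it. -/
def Originates (M : Model) (t : Msg) (n : Node) : Prop :=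
  (∃ m, Sends M n m ∧ Carries t m) ∧
    ∀ i < n.2, ∀ m, HasMsg M (n.1, i) m → ¬ Carries t m

/-- The basic exponent `a` is generated at `n`: it appears in a message sent there, and at no
earlier node of the strand. -/
def Generates (M : Model) (a : ℕ) (n : Node) : Prop :=
  (∃ m, Sends M n m ∧ ExptAppears a m) ∧
    ∀ i < n.2, ∀ m, HasMsg M (n.1, i) m → ¬ ExptAppears a m

namespace Bundle

variable {M : Model}

/-- `t` is carried by no message of the bundle. -/
def NonOriginating (B : Bundle M) (t : Msg) : Prop :=
  ∀ n ∈ B.nodes, ∀ m, HasMsg M n m → ¬ Carries t m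

/-- `t` originates on `s`, at exactly one node, and nowhere else in the bundle. -/
def UniquelyOriginating (B : Bundle M) (t : Msg) (s : Strand) : Prop :=
  ∃ n ∈ B.nodes, n.1 = s ∧ Originates M t n ∧ ∀ n' ∈ B.nodes, Originates M t n' → n' = n

/-- `a` is generated on `s`, at exactly one node, and nowhere else in the bundle. -/
def UniquelyGenerated (B : Bundle M) (a : ℕ) (s : Strand) : Prop :=
  ∃ n ∈ B.nodes, n.1 = s ∧ Generates M a n ∧ ∀ n' ∈ B.nodes, Generates M a n' → n' = n

/-- The declaration that belongs to every role: a role instance uniquely generates its own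
Diffie-Hellman exponent (as soon as its part in the bundle uses that exponent). -/
def FreshExponents (B : Bundle M) : Prop :=
  ∀ (s : Strand) (a : Instance), s.kind = .honest a →
    (∃ i m, (s, i) ∈ B.nodes ∧ HasMsg M (s, i) m ∧ ExptAppears a.ownExp m) →
    B.UniquelyGenerated a.ownExp s

end Bundle

/-- The server's origination assumptions for registration: the private keys of the certificate
authority, of the server, of the authenticator (attestation) and of the registered key pair are
non-originating; the server random, the challenge and the username uniquely originate on the
server's strand, and its exponent is uniquely generated there. -/
structure ServerRegOrig (M : Model) (B : Bundle M) (s : Strand) (t : TLSVars) (v : RegVars) :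
    Prop where
  ca_key : B.NonOriginating (.priv (.ofName t.ca))
  server_key : B.NonOriginating (.priv t.spk)
  attestation_key : B.NonOriginating (.priv (.ofName v.aaid))
  auth_key : B.NonOriginating (.priv v.authk)
  server_random : B.UniquelyOriginating (.rand t.sr) s
  exponent : B.UniquelyGenerated t.ownExp s
  challenge : B.UniquelyOriginating (.text v.challenge) s
  username : B.UniquelyOriginating (.name v.username) s

def serverRegOrig (M : Model) (B : Bundle M) (s : Strand) : Prop :=
  ∃ t v, s.kind = .honest (.reg .server t v) ∧ ServerRegOrig M B s t v

/-! ## Session contexts and session context agreement -/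

inductive Var
  | server
  | ca
  | cr
  | sr
  | x
  | y
  | username
  | appid
  | challenge

def TLSSession.value (t : TLSSession) : Var → Option Msg
  | .server => some (.name t.server)
  | .ca => some (.name t.ca)
  | .cr => some (.rand t.cr)
  | .sr => some (.rand t.sr)
  | .x => some (.expt t.x)
  | .y => some (.expt t.y)
  | _ => none

/-- The value of a variable on a strand, if the strand has that variable. -/
noncomputable def Strand.value (s : Strand) (z : Var) : Option Msg :=
  match s.kind, z with
  | .honest (.reg _ _ v), .username => some (.name v.username)
  | .honest (.reg _ _ v), .appid => some (.name v.appid)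
  | .honest (.reg _ _ v), .challenge => some (.text v.challenge)
  | .honest (.auth _ _ v), .appid => some (.name v.appid)
  | .honest (.auth _ _ v), .challenge => some (.text v.challenge)
  | .honest (.reg side t _), z => (t.session side).value z
  | .honest (.auth side t _), z => (t.session side).value z
  | .penetrator _, _ => none

/-- A session context, as the list of the variables to be agreed on. -/
abbrev Context := List Var

def tlsDHContext : Context := [.server, .ca, .cr, .sr, .x, .y]

def regContext : Context := tlsDHContext ++ [.challenge, .username, .server, .appid]

/-- The two strands satisfy the context: both have all of its variables, with equal values. -/
def Context.Agree (C : Context) (s s' : Strand) : Prop :=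
  ∀ z ∈ C, ∃ m, s.value z = some m ∧ s'.value z = some m

def Strand.HasRole (s : Strand) (R : Role) : Prop :=
  ∃ a, s.kind = .honest a ∧ a.role = R

/-- One of the strands is a client and the other one is a server. -/
def Strand.Complementary (s s' : Strand) : Prop :=
  ∃ R R' : Role, s.HasRole R ∧ s'.HasRole R' ∧
    ((R.side = .client ∧ R'.side = .server) ∨ (R.side = .server ∧ R'.side = .client))

/-- Successful completion. -/
def Succ (M : Model) (Ra Rb : Role) (C : Context) (Orig : Bundle M → Strand → Prop)
    (i j : ℕ) : Prop :=
  ∀ B : Bundle M, B.FreshExponents →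
    ∀ s : Strand, s.HasRole Ra → B.Contains s → Orig B s → i ≤ B.height s →
      ∃ s' : Strand, s'.HasRole Rb ∧ B.Contains s' ∧ s.Complementary s' ∧
        j ≤ B.height s' ∧ C.Agree s s'

/-- Unique completion. -/
def Uniq (M : Model) (Ra : Role) (C : Context) (Orig : Bundle M → Strand → Prop)
    (i j : ℕ) : Prop :=
  ∀ Rb Rc : Role, Succ M Ra Rb C Orig i j ∧ Succ M Ra Rc C Orig i j → Rb = Rc

/-- Session context agreement between the roles `Ra` and `Rb`. -/
def SessionContextAgreement (M : Model) (Ra Rb : Role) (C : Context)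
    (Orig : Bundle M → Strand → Prop) : Prop :=
  ∃ j ≤ Rb.height M, Succ M Ra Rb C Orig (Ra.height M) j ∧ Uniq M Ra C Orig (Ra.height M) j

/-! ## The ideal execution -/

/-- The server strand `s` and the client strand `s'` both run registration to completion in the
bundle, agree on the registration context, and each receives exactly the messages that the other
one sends. -/
structure IdealExecution (M : Model) (B : Bundle M) (s s' : Strand) : Prop where
  server_role : s.HasRole .serverReg
  client_role : s'.HasRole .clientReg
  server_complete : B.height s = Role.serverReg.height M
  client_complete : B.height s' = Role.clientReg.height M
  agree : regContext.Agree s s'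
  mirror : s'.trace M = (s.trace M).map fun e => (e.1.flip, e.2)

/-- The ideal execution is the only shape for a complete `server-reg` strand under the server's
assumptions: it can occur with no further strands, and every bundle with such a server strand
contains it, with exactly one client strand, which is the only other strand that completes a run
with the same session context. -/
structure UniqueIdealShape (M : Model) : Prop where
  realized : ∃ (B : Bundle M) (s s' : Strand), B.FreshExponents ∧ serverRegOrig M B s ∧
    IdealExecution M B s s' ∧ ∀ n ∈ B.nodes, n.1 = s ∨ n.1 = s'
  unique : ∀ B : Bundle M, B.FreshExponents → ∀ s : Strand, s.HasRole .serverReg →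
    serverRegOrig M B s → Role.serverReg.height M ≤ B.height s →
    ∃ s' : Strand, IdealExecution M B s s' ∧
      ∀ (u : Strand) (R : Role), u.HasRole R → R.height M ≤ B.height u →
        regContext.Agree s u → u = s ∨ u = s'

end UAF

/-! The server's last message carries an assertion signed with the attestation key. The penetrator
makes no encryption under a key that no message carries (`exists_honest_sends_enc`), so an honest
strand sent the assertion, and the shapes of the protocol messages force it to be a client-reg
strand at its last node. The assertion fixes challenge, appid, authenticator, registered key and
channel binding, but neither the username nor the whole TLS session.

The rest comes from the challenge message that this client received under its own server write key.
That key is secret because the client's shared secret is (`nonOriginating_sharedSecret`): group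
elements that depend on the basic exponents of two different honest strands are never carried
(`secret_exponents`). With a TLS 1.2 binding, client and server share the certified key, so the
exponent signed with it is an honest one. With the exporter binding, the two shared secrets are
equal, so they depend on both secret exponents. Hence an honest server-reg strand sent the challenge
message, and since the challenge originates only once, it is the given strand. This yields the
username and equal write keys, hence equal randoms and equal `x + y`. The signed exponent, tied to
the given strand by `sr`, separates `y` from `x` (`exists_matching_client`).

Equal sessions make the two traces mirror images. Another complete strand with the same context
would originate the same challenge or generate the same `x`. Conversely, two mirror-image strands
with suitable values form a bundle by themselves. It realizes the shape, and having no third strand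
it also shows that no role but client-reg fits. -/

namespace UAF

/-! ## Carried components -/

section Carries

variable {t a b m k : Msg}

@[simp] theorem Carries.rfl : Carries t t := .refl

@[simp] theorem carries_pair : Carries t (a ⋄ b) ↔ t = a ⋄ b ∨ Carries t a ∨ Carries t b := by
  constructor
  · rintro (_ | h | h | _)
    · exact .inl rfl
    · exact .inr (.inl h)
    · exact .inr (.inr h)
  · rintro (rfl | h | h)
    exacts [.refl, .left h, .right h]

@[simp] theorem carries_enc : Carries t (.enc m k) ↔ t = .enc m k ∨ Carries t m := by
  constructor
  · rintro (_ | _ | _ | h)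
    exacts [.inl rfl, .inr h]
  · rintro (rfl | h)
    exacts [.refl, .body h]

@[simp] theorem carries_hash : Carries t (.hash m) ↔ t = .hash m :=
  ⟨fun h => by cases h; rfl, fun h => h ▸ .refl⟩

@[simp] theorem carries_tag {c : Tag} : Carries t (.tag c) ↔ t = .tag c :=
  ⟨fun h => by cases h; rfl, fun h => h ▸ .refl⟩

@[simp] theorem carries_name {n : ℕ} : Carries t (.name n) ↔ t = .name n :=
  ⟨fun h => by cases h; rfl, fun h => h ▸ .refl⟩

@[simp] theorem carries_text {n : ℕ} : Carries t (.text n) ↔ t = .text n :=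
  ⟨fun h => by cases h; rfl, fun h => h ▸ .refl⟩

@[simp] theorem carries_rand {n : ℕ} : Carries t (.rand n) ↔ t = .rand n :=
  ⟨fun h => by cases h; rfl, fun h => h ▸ .refl⟩

@[simp] theorem carries_pub {p : KeyPair} : Carries t (.pub p) ↔ t = .pub p :=
  ⟨fun h => by cases h; rfl, fun h => h ▸ .refl⟩

@[simp] theorem carries_priv {p : KeyPair} : Carries t (.priv p) ↔ t = .priv p :=
  ⟨fun h => by cases h; rfl, fun h => h ▸ .refl⟩

@[simp] theorem carries_expt {e : Expt} : Carries t (.expt e) ↔ t = .expt e :=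
  ⟨fun h => by cases h; rfl, fun h => h ▸ .refl⟩

@[simp] theorem carries_gexp {e : Expt} : Carries t (.gexp e) ↔ t = .gexp e :=
  ⟨fun h => by cases h; rfl, fun h => h ▸ .refl⟩

end Carries

/-- A message that the penetrator can create carries only itself. -/
theorem Msg.Basic.eq_of_carries {t m : Msg} (hm : m.Basic) (h : Carries t m) : t = m := by
  cases m <;> simp_all [Msg.Basic]

/-! ### Basic exponents and one-step deductions of the penetrator. -/

theorem basicExpt_injective : Function.Injective basicExpt := fun a b h => by
  simpa [basicExpt, Finsupp.single_left_inj] using h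

@[simp] theorem basicExpt_apply_self (a : ℕ) : basicExpt a a = 1 := by simp [basicExpt]

theorem basicExpt_apply_of_ne {a b : ℕ} (h : a ≠ b) : basicExpt a b = 0 := by
  simp [basicExpt, h]

/-- `Derives P m`: the message `m` results by one step of the penetrator from messages that
satisfy `P`. -/
inductive Derives (P : Msg → Prop) : Msg → Prop
  | copy {m} : P m → Derives P m
  | concat {a b} : P a → P b → Derives P (a ⋄ b)
  | fst {a b} : P (a ⋄ b) → Derives P a
  | snd {a b} : P (a ⋄ b) → Derives P b
  | encrypt {m k} : P k → P m → Derives P (.enc m k)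
  | decrypt {m k : Msg} : P k.inv → P (.enc m k) → Derives P m
  | hash {m} : P m → Derives P (.hash m)
  | power {e e'} : P (.gexp e) → P (.expt e') → Derives P (.gexp (e + e'))
  | mul {e e'} : P (.expt e) → P (.expt e') → Derives P (.expt (e + e'))
  | inv {e} : P (.expt e) → Derives P (.expt (-e))

/-- Used to weaken the induction hypothesis of `secrecy_induction` to the part that a case analysis
needs. -/
theorem Derives.mono {P Q : Msg → Prop} (h : ∀ m, P m → Q m) {m : Msg} (hm : Derives P m) :
    Derives Q m := by
  cases hm with
  | copy h1 => exact .copy (h _ h1)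
  | concat h1 h2 => exact .concat (h _ h1) (h _ h2)
  | fst h1 => exact .fst (h _ h1)
  | snd h1 => exact .snd (h _ h1)
  | encrypt h1 h2 => exact .encrypt (h _ h1) (h _ h2)
  | decrypt h1 h2 => exact .decrypt (h _ h1) (h _ h2)
  | hash h1 => exact .hash (h _ h1)
  | power h1 h2 => exact .power (h _ h1) (h _ h2)
  | mul h1 h2 => exact .mul (h _ h1) (h _ h2)
  | inv h1 => exact .inv (h _ h1)

/-- The only case split over penetrator strands; `P` is free so that it serves every invariant. Only
`create` sends without having received anything, hence `i = 0`. -/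
theorem Penetrator.basic_or_derives (p : Penetrator) {i : ℕ} {m : Msg} {P : Msg → Prop}
    (hs : p.trace[i]? = some (.send, m))
    (hr : ∀ j < i, ∀ x, p.trace[j]? = some (.recv, x) → P x) :
    (i = 0 ∧ m.Basic) ∨ Derives P m := by
  cases p with
  | create c h => rcases i with _ | i <;> simp [Penetrator.trace] at hs; subst hs; exact .inl ⟨rfl, h⟩
  | flush c => rcases i with _ | i <;> simp [Penetrator.trace] at hs
  | tee c =>
    rcases i with _ | _ | _ | i <;> simp [Penetrator.trace] at hs <;> subst hs <;>
      exact .inr (.copy (hr 0 (by simp) _ rfl))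
  | concat a b =>
    rcases i with _ | _ | _ | i <;> simp [Penetrator.trace] at hs; subst hs
    exact .inr (.concat (hr 0 (by simp) _ rfl) (hr 1 (by simp) _ rfl))
  | separate a b =>
    rcases i with _ | _ | _ | i <;> simp [Penetrator.trace] at hs <;> subst hs
    · exact .inr (.fst (hr 0 (by simp) _ rfl))
    · exact .inr (.snd (hr 0 (by simp) _ rfl))
  | encrypt c k =>
    rcases i with _ | _ | _ | i <;> simp [Penetrator.trace] at hs; subst hs
    exact .inr (.encrypt (hr 0 (by simp) _ rfl) (hr 1 (by simp) _ rfl))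
  | decrypt c k =>
    rcases i with _ | _ | _ | i <;> simp [Penetrator.trace] at hs; subst hs
    exact .inr (.decrypt (hr 0 (by simp) _ rfl) (hr 1 (by simp) _ rfl))
  | hash c =>
    rcases i with _ | _ | i <;> simp [Penetrator.trace] at hs; subst hs
    exact .inr (.hash (hr 0 (by simp) _ rfl))
  | power e e' =>
    rcases i with _ | _ | _ | i <;> simp [Penetrator.trace] at hs; subst hs
    exact .inr (.power (hr 0 (by simp) _ rfl) (hr 1 (by simp) _ rfl))
  | mul e e' =>
    rcases i with _ | _ | _ | i <;> simp [Penetrator.trace] at hs; subst hs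
    exact .inr (.mul (hr 0 (by simp) _ rfl) (hr 1 (by simp) _ rfl))
  | inv e =>
    rcases i with _ | _ | i <;> simp [Penetrator.trace] at hs; subst hs
    exact .inr (.inv (hr 0 (by simp) _ rfl))

/-! ## Induction along a bundle -/

variable {M : Model}

theorem HasMsg.unique {n : Node} {m m' : Msg} (h : HasMsg M n m) (h' : HasMsg M n m') :
    m = m' := by
  rcases h with h | h <;> rcases h' with h' | h' <;> simp_all [Sends, Receives]

/-- The first message of its strand that satisfies `P` is sent at the node `n`. -/
def FirstSends (M : Model) (P : Msg → Prop) (n : Node) : Prop :=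
  (∃ m, Sends M n m ∧ P m) ∧ ∀ i < n.2, ∀ m, HasMsg M (n.1, i) m → ¬ P m

namespace Bundle

variable (B : Bundle M)

theorem mem_of_le {s : Strand} {i j : ℕ} (hij : i ≤ j) (hj : (s, j) ∈ B.nodes) :
    (s, i) ∈ B.nodes := by
  induction j, hij using Nat.le_induction with
  | base => exact hj
  | succ j _ ih => exact ih (B.down_closed s j hj)

/-- One step of the causal order of the bundle. -/
def Step (a b : Node) : Prop :=
  B.edge a b ∨ (a ∈ B.nodes ∧ b ∈ B.nodes ∧ b.1 = a.1 ∧ b.2 = a.2 + 1)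

theorem wellFoundedOn_transGen_step : B.nodes.WellFoundedOn (Relation.TransGen B.Step) := by
  have : IsStrictOrder Node (Relation.TransGen B.Step) :=
    { irrefl := B.acyclic
      trans := fun _ _ _ => Relation.TransGen.trans }
  exact B.finite.wellFoundedOn

theorem transGen_step_of_lt {s : Strand} {i j : ℕ} (hij : i < j) (hj : (s, j) ∈ B.nodes) :
    Relation.TransGen B.Step (s, i) (s, j) := by
  induction j, hij using Nat.le_induction with
  | base => exact .single (.inr ⟨B.down_closed s i hj, hj, rfl, rfl⟩)
  | succ j _ ih =>
    exact .tail (ih (B.down_closed s j hj)) (.inr ⟨B.down_closed s j hj, hj, rfl, rfl⟩)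

/-- A property of messages holds throughout the bundle if every strand preserves it: it holds of
a sent message as soon as it holds of all earlier messages of the strand. -/
theorem msg_induction {P : Msg → Prop}
    (hP : ∀ s i m, (s, i) ∈ B.nodes → Sends M (s, i) m →
      (∀ j < i, ∀ m', (s, j) ∈ B.nodes → HasMsg M (s, j) m' → P m') → P m) :
    ∀ n ∈ B.nodes, ∀ m, HasMsg M n m → P m := by
  intro n hn
  refine B.wellFoundedOn_transGen_step.induction hn (P := fun n => ∀ m, HasMsg M n m → P m) ?_
  · intro n hn ih
    -- Sending nodes are treated at `n` and everywhere below it: a reception at `n` reduces to its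
    -- sender, which precedes `n`, so the induction hypothesis still covers the sender's past.
    have key : ∀ n' ∈ B.nodes, (n' = n ∨ Relation.TransGen B.Step n' n) →
        ∀ m, Sends M n' m → P m := by
      rintro ⟨s, i⟩ hn' hle m hm
      refine hP s i m hn' hm fun j hj m' _ hm' => ?_
      have hlt := B.transGen_step_of_lt hj hn'
      refine ih _ (B.mem_of_le hj.le hn') ?_ m' hm'
      rcases hle with rfl | hle
      exacts [hlt, hlt.trans hle]
    rintro m (hm | hm)
    · exact key n hn (.inl rfl) m hm
    · obtain ⟨n', hn', -⟩ := B.recv_unique n hn m hm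
      obtain ⟨hn'B, -, -, m', hs, hr⟩ := B.edge_spec _ _ hn'
      obtain rfl := HasMsg.unique (.inr hm) (.inr hr)
      exact key n' hn'B (.inr (.single (.inl hn'))) m hs

/-- Induction along a bundle, with the penetrator strands split by what they do. The penetrator
works with messages that carry no non-originating message `k`. -/
theorem secrecy_induction {P : Msg → Prop}
    (honest : ∀ s a i m, s.kind = .honest a → (s, i) ∈ B.nodes → Sends M (s, i) m → P m)
    (create : ∀ s m, (s, 0) ∈ B.nodes → Sends M (s, 0) m → m.Basic → P m)
    (derive_step : ∀ m, Derives (fun x => P x ∧ ∀ k, B.NonOriginating k → ¬ Carries k x) m → P m) :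
    ∀ n ∈ B.nodes, ∀ m, HasMsg M n m → P m := by
  refine B.msg_induction fun s i m hsi hs hi => ?_
  rcases hkind : s.kind with a | p
  · exact honest s a i m hkind hsi hs
  have htr : s.trace M = p.trace := by simp [Strand.trace, hkind]
  have hs' : p.trace[i]? = some (.send, m) := by rwa [Sends, htr] at hs
  have hr : ∀ j < i, ∀ x, p.trace[j]? = some (.recv, x) →
      P x ∧ ∀ k, B.NonOriginating k → ¬ Carries k x := fun j hj x hx =>
    have hsj := B.mem_of_le hj.le hsi
    have hx' : HasMsg M (s, j) x := .inr (by rwa [Receives, htr])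
    ⟨hi j hj x hsj hx', fun k hk => hk _ hsj x hx'⟩
  rcases p.basic_or_derives hs' hr with ⟨rfl, hb⟩ | hd
  · exact create s m hsi hs hb
  · exact derive_step m hd

/-! ## Origination at honest strands -/

/-- The penetrator makes no encryption whose key it does not learn. -/
theorem exists_honest_sends_enc {t k : Msg} (hk : B.NonOriginating k) {n : Node}
    (hn : n ∈ B.nodes) {m : Msg} (hm : HasMsg M n m) (h : Carries (.enc t k) m) :
    ∃ s a i m', s.kind = .honest a ∧ (s, i) ∈ B.nodes ∧ Sends M (s, i) m' ∧
      Carries (.enc t k) m' := by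
  by_contra! hno
  -- Not carrying the encryption is an invariant: basic messages are no encryptions, and the only
  -- deduction that builds it has the secret key as a premise.
  refine B.secrecy_induction (P := fun m => ¬ Carries (.enc t k) m) hno
    (fun _ m _ _ hb hc => ?_) (fun m hd hc => ?_) n hn m hm h
  · have := hb.eq_of_carries hc
    subst this
    exact hb
  · have hd := hd.mono (Q := fun x => ¬ Carries (.enc t k) x ∧ ¬ Carries k x)
      fun x hx => ⟨hx.1, hx.2 k hk⟩
    cases hd <;> simp_all

/-- A hash is secret if its body is and no honest strand sends it. -/
theorem NonOriginating.hash {B : Bundle M} {b : Msg} (hb : B.NonOriginating b)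
    (hon : ∀ s a i m, s.kind = .honest a → Sends M (s, i) m → ¬ Carries (.hash b) m) :
    B.NonOriginating (.hash b) := by
  refine B.secrecy_induction (P := fun m => ¬ Carries (.hash b) m)
    (fun s a i m hk _ hs => hon s a i m hk hs) (fun _ m _ _ hm hc => ?_) (fun m hd hc => ?_)
  · have := hm.eq_of_carries hc
    subst this
    exact hm
  · have hd := hd.mono (Q := fun x => ¬ Carries (.hash b) x ∧ ¬ Carries b x)
      fun x hx => ⟨hx.1, hx.2 b hb⟩
    cases hd <;> simp_all

/-- Whatever carries a pair carries its components. Keys are hashes of tuples of which only one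
component is secret. -/
theorem NonOriginating.pair_left {B : Bundle M} {a b : Msg} (h : B.NonOriginating a) :
    B.NonOriginating (a ⋄ b) := by
  intro n hn m hm hc
  refine h n hn m hm ?_
  clear hm
  induction hc with
  | refl => exact .left .refl
  | left _ ih => exact .left ih
  | right _ ih => exact .right ih
  | body _ ih => exact .body ih

theorem NonOriginating.pair_right {B : Bundle M} {a b : Msg} (h : B.NonOriginating b) :
    B.NonOriginating (a ⋄ b) := by
  intro n hn m hm hc
  refine h n hn m hm ?_
  clear hm
  induction hc with
  | refl => exact .right .refl
  | left _ ih => exact .left ih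
  | right _ ih => exact .right ih
  | body _ ih => exact .body ih

/-! ## Heights -/

theorem height_eq_of_mem {s : Strand} {k : ℕ} (hlen : (s.trace M).length = k + 1)
    (h : (s, k) ∈ B.nodes) : B.height s = k + 1 := by
  have : {i : ℕ | (s, i) ∈ B.nodes} = Set.Iio (k + 1) := by
    ext i
    refine ⟨fun hi => ?_, fun hi => B.mem_of_le (Nat.lt_succ_iff.mp hi) h⟩
    have := B.valid _ hi
    simp_all
  rw [height, this, Set.ncard_Iio_nat]

theorem mem_of_lt_height {s : Strand} {k : ℕ} (h : k < B.height s) : (s, k) ∈ B.nodes := by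
  by_contra hk
  have hsub : {i : ℕ | (s, i) ∈ B.nodes} ⊆ Set.Iio k := fun i hi => by
    by_contra hik
    exact hk (B.mem_of_le (not_lt.mp hik) hi)
  have := Set.ncard_le_ncard hsub (Set.finite_Iio k)
  rw [Set.ncard_Iio_nat] at this
  exact absurd h (not_lt.mpr this)

end Bundle

open Msg

/-! ## What honest strands send -/

namespace Instance

def side : Instance → Side
  | .reg side _ _ => side
  | .auth side _ _ => side

def tls : Instance → TLSVars
  | .reg _ t _ => t
  | .auth _ t _ => t

noncomputable def session (a : Instance) : TLSSession := a.tls.session a.side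

end Instance

/-- The signature by which the server authenticates its exponent. -/
noncomputable def Model.serverSignature : Model → TLSSession → Msg
  | .exporterTLS13, t => t.certificateVerify13
  | _, t => enc (rand t.cr ⋄ rand t.sr ⋄ gexp t.y) (priv t.spk)

section HonestStrands

variable {s : Strand} {a : Instance} {i : ℕ} {m : Msg}

theorem sends_iff_of_honest (hk : s.kind = .honest a) :
    Sends M (s, i) m ↔ (a.trace M)[i]? = some (.send, m) := by
  simp [Sends, Strand.trace, hk]

theorem hasMsg_iff_of_honest (hk : s.kind = .honest a) :
    HasMsg M (s, i) m ↔ ∃ g, (a.trace M)[i]? = some (g, m) := by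
  simp only [HasMsg, Sends, Receives, Strand.trace, hk]
  constructor
  · rintro (h | h) <;> exact ⟨_, h⟩
  · rintro ⟨_ | _, h⟩
    exacts [.inl h, .inr h]

/-- The signed bodies are told apart by shape: an assertion is name, hash, public key; a certificate
has no hash; the other signatures start with a random, a tag or a hash. Session keys are hashes, so
they are no signing keys. -/
theorem eq_of_carries_regAssertion {t : TLSSession} {v : RegVars} (hk : s.kind = .honest a)
    (hs : Sends M (s, i) m) (h : Carries (M.regAssertion t v) m) :
    ∃ t' v', a = .reg .client t' v' ∧ i + 1 = Role.clientReg.height M ∧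
      M.regAssertion (t'.session .client) v' = M.regAssertion t v := by
  rw [sends_iff_of_honest hk] at hs
  cases M <;> rcases a with ⟨_ | _, t', v'⟩ | ⟨_ | _, t', v'⟩ <;>
    rcases i with _ | _ | _ | _ | _ | _ | i <;>
    simp [Instance.trace, Model.regFlow, Model.authFlow, Model.tlsFlow, TLSSession.flow12,
      TLSSession.flow13, Side.sign, Role.height] at hs ⊢ <;>
    subst hs <;>
    simp [Model.regAssertion, Model.authAssertion, Model.finalChallenge, TLSSession.serverFlight12,
      TLSSession.certificate, TLSSession.clientFinished12, TLSSession.serverFinished12,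
      TLSSession.certificateVerify13, TLSSession.serverFinished13, TLSSession.clientFinished13]
      at h ⊢
  all_goals grind

/-- Registration and authentication share the handshake, so the signer may be a server of either
kind; `sr` identifies it later. -/
theorem eq_of_carries_serverSignature {t : TLSSession} (hk : s.kind = .honest a)
    (hs : Sends M (s, i) m) (h : Carries (M.serverSignature t) m) :
    a.side = .server ∧ i = 1 ∧ a.session.cr = t.cr ∧ a.session.sr = t.sr ∧
      a.session.y = t.y := by
  rw [sends_iff_of_honest hk] at hs
  cases M <;> rcases a with ⟨_ | _, t', v'⟩ | ⟨_ | _, t', v'⟩ <;>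
    rcases i with _ | _ | _ | _ | _ | _ | i <;>
    simp [Instance.trace, Model.regFlow, Model.authFlow, Model.tlsFlow, TLSSession.flow12,
      TLSSession.flow13, Side.sign] at hs <;>
    subst hs <;>
    simp [Model.regAssertion, Model.authAssertion, Model.finalChallenge, TLSSession.serverFlight12,
      TLSSession.certificate, TLSSession.clientFinished12, TLSSession.serverFinished12,
      TLSSession.certificateVerify13, TLSSession.serverFinished13, TLSSession.clientFinished13,
      Model.serverSignature, TLSSession.hellos13] at h
  all_goals simp [Instance.side, Instance.session, Instance.tls, h]

/-- The username gives this body three components, which excludes the challenge message of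
authentication. -/
theorem eq_of_carries_challenge {t : TLSSession} {u p c : ℕ} (hk : s.kind = .honest a)
    (hs : Sends M (s, i) m)
    (h : Carries (enc (name u ⋄ name p ⋄ text c) (M.swk t)) m) :
    ∃ t' v', a = .reg .server t' v' ∧ i + 2 = Role.serverReg.height M ∧ v'.username = u ∧ v'.appid = p ∧
      v'.challenge = c ∧ M.swk (t'.session .server) = M.swk t := by
  rw [sends_iff_of_honest hk] at hs
  cases M <;> rcases a with ⟨_ | _, t', v'⟩ | ⟨_ | _, t', v'⟩ <;>
    rcases i with _ | _ | _ | _ | _ | _ | i <;>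
    simp [Instance.trace, Model.regFlow, Model.authFlow, Model.tlsFlow, TLSSession.flow12,
      TLSSession.flow13, Side.sign, Role.height] at hs ⊢ <;>
    subst hs <;>
    simp [Model.regAssertion, Model.authAssertion, Model.finalChallenge, TLSSession.serverFlight12,
      TLSSession.certificate, TLSSession.clientFinished12, TLSSession.serverFinished12,
      TLSSession.certificateVerify13, TLSSession.serverFinished13, TLSSession.clientFinished13]
      at h ⊢
  all_goals simp [h]

theorem not_carries_expt (hk : s.kind = .honest a) (hs : Sends M (s, i) m) (e : Expt) :
    ¬ Carries (expt e) m := by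
  rw [sends_iff_of_honest hk] at hs
  cases M <;> rcases a with ⟨_ | _, t', v'⟩ | ⟨_ | _, t', v'⟩ <;>
    rcases i with _ | _ | _ | _ | _ | _ | i <;>
    simp [Instance.trace, Model.regFlow, Model.authFlow, Model.tlsFlow, TLSSession.flow12,
      TLSSession.flow13, Side.sign] at hs <;>
    subst hs <;>
    simp [Model.regAssertion, Model.authAssertion, Model.finalChallenge, TLSSession.serverFlight12,
      TLSSession.certificate, TLSSession.clientFinished12, TLSSession.serverFinished12,
      TLSSession.certificateVerify13, TLSSession.serverFinished13, TLSSession.clientFinished13]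

/-- The peer's public value enters sent messages only inside hashes. -/
theorem eq_of_carries_gexp (hk : s.kind = .honest a) (hs : Sends M (s, i) m) {e : Expt}
    (h : Carries (gexp e) m) : e = basicExpt a.ownExp := by
  rw [sends_iff_of_honest hk] at hs
  cases M <;> rcases a with ⟨_ | _, t', v'⟩ | ⟨_ | _, t', v'⟩ <;>
    rcases i with _ | _ | _ | _ | _ | _ | i <;>
    simp [Instance.trace, Model.regFlow, Model.authFlow, Model.tlsFlow, TLSSession.flow12,
      TLSSession.flow13, Side.sign] at hs <;>
    subst hs <;>
    simp [Model.regAssertion, Model.authAssertion, Model.finalChallenge, TLSSession.serverFlight12,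
      TLSSession.certificate, TLSSession.clientFinished12, TLSSession.serverFinished12,
      TLSSession.certificateVerify13, TLSSession.serverFinished13, TLSSession.clientFinished13]
      at h
  all_goals simp [TLSVars.session, h, Instance.ownExp]

/-- Honest strands keep the secrets that they derive their keys from. -/
theorem not_carries_hash_tag (hk : s.kind = .honest a) (hs : Sends M (s, i) m) {c : Tag}
    (hc : c = .masterSecret ∨ c = .handshakeSecret ∨ c = .serverWriteKey) (b : Msg) :
    ¬ Carries (hash (tag c ⋄ b)) m := by
  rw [sends_iff_of_honest hk] at hs
  cases M <;> rcases a with ⟨_ | _, t', v'⟩ | ⟨_ | _, t', v'⟩ <;>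
    rcases i with _ | _ | _ | _ | _ | _ | i <;>
    simp [Instance.trace, Model.regFlow, Model.authFlow, Model.tlsFlow, TLSSession.flow12,
      TLSSession.flow13, Side.sign] at hs <;>
    subst hs <;>
    simp [Model.regAssertion, Model.authAssertion, Model.finalChallenge, TLSSession.serverFlight12,
      TLSSession.certificate, TLSSession.clientFinished12, TLSSession.serverFinished12,
      TLSSession.certificateVerify13, TLSSession.serverFinished13, TLSSession.clientFinished13,
      TLSSession.hellos13]
  -- The sent hashes that begin with a tag are the finished messages, and their tags are none of
  -- these three.
  all_goals rcases hc with rfl | rfl | rfl <;> simp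

/-! ## Origination on honest strands -/

/-- `Originates` and `Generates` unfold to `FirstSends` for `Carries t` and `ExptAppears a`, so this
serves both. -/
theorem firstSends_of_honest {P : Msg → Prop} (hk : s.kind = .honest a)
    (hm : (a.trace M)[i]? = some (.send, m)) (hP : P m)
    (hlt : ∀ j < i, ∀ e, (a.trace M)[j]? = some e → ¬ P e.2) : FirstSends M P (s, i) :=
  ⟨⟨m, (sends_iff_of_honest hk).2 hm, hP⟩, fun j hj m' hm' => by
    obtain ⟨g, hg⟩ := (hasMsg_iff_of_honest hk).1 hm'
    exact hlt j hj _ hg⟩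

/-- Handshake messages carry no text at all. -/
theorem originates_challenge {t : TLSVars} {v : RegVars}
    (hk : s.kind = .honest (.reg .server t v)) (hi : i + 2 = Role.serverReg.height M) :
    Originates M (text v.challenge) (s, i) := by
  refine firstSends_of_honest (m := enc (name v.username ⋄ name v.appid ⋄ text v.challenge)
    (M.swk (t.session .server))) hk ?_ (by simp) ?_
  · cases M <;> simp [Role.height] at hi <;> subst hi <;> rfl
  · intro j hj e he
    cases M <;> simp [Role.height] at hi <;> subst hi <;> interval_cases j <;>
      simp [Instance.trace, Model.regFlow, Model.tlsFlow, TLSSession.flow12,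
        TLSSession.flow13, Side.sign] at he <;>
      subst he <;>
      simp [TLSSession.serverFlight12, TLSSession.certificate, TLSSession.clientFinished12,
        TLSSession.serverFinished12, TLSSession.certificateVerify13, TLSSession.serverFinished13,
        TLSSession.clientFinished13]

/-- Before its own hello the server has only received the client hello, whose random is `cr`. -/
theorem originates_rand (hk : s.kind = .honest a) (hside : a.side = .server)
    (hne : a.session.cr ≠ a.session.sr) : Originates M (rand a.session.sr) (s, 1) := by
  have h1 : ∃ m, (a.trace M)[1]? = some (.send, m) ∧ Carries (rand a.session.sr) m := by
    cases M <;> rcases a with ⟨_ | _, t', v'⟩ | ⟨_ | _, t', v'⟩ <;>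
      simp [Instance.side] at hside <;>
      simp [Instance.trace, Model.regFlow, Model.authFlow, Model.tlsFlow, TLSSession.flow12,
        TLSSession.flow13, Side.sign, Instance.session, Instance.side, Instance.tls,
        TLSSession.serverFlight12]
  obtain ⟨m, hm, hc⟩ := h1
  refine firstSends_of_honest hk hm hc fun j hj e he => ?_
  obtain rfl : j = 0 := by omega
  cases M <;> rcases a with ⟨_ | _, t', v'⟩ | ⟨_ | _, t', v'⟩ <;>
    simp [Instance.side] at hside <;>
    simp [Instance.trace, Model.regFlow, Model.authFlow, Model.tlsFlow, TLSSession.flow12,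
      TLSSession.flow13, Side.sign] at he <;>
    subst he <;>
    simpa [eq_comm, Instance.session, Instance.side, Instance.tls] using hne

/-- A server whose random originates on its strand does not receive it as the client random. -/
theorem cr_ne_sr_of_originates (hk : s.kind = .honest a) (hside : a.side = .server)
    (ho : Originates M (rand a.session.sr) (s, i)) : a.session.cr ≠ a.session.sr := by
  intro heq
  obtain ⟨⟨m, hs, hc⟩, hlt⟩ := ho
  have h0 : ∃ m, (a.trace M)[0]? = some (.recv, m) ∧ Carries (rand a.session.sr) m := by
    rw [← heq]
    cases M <;> rcases a with ⟨_ | _, t', v'⟩ | ⟨_ | _, t', v'⟩ <;>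
      simp [Instance.side] at hside <;>
      simp [Instance.trace, Model.regFlow, Model.authFlow, Model.tlsFlow, TLSSession.flow12,
        TLSSession.flow13, Side.sign, Instance.session, Instance.side, Instance.tls]
  obtain ⟨m0, hm0, hc0⟩ := h0
  rcases Nat.eq_zero_or_pos i with rfl | hi
  · rw [sends_iff_of_honest hk, hm0] at hs
    simp at hs
  · exact hlt 0 hi m0 ((hasMsg_iff_of_honest hk).2 ⟨_, hm0⟩) hc0

/-! ## What honest strands receive -/

theorem exists_receives_serverSignature {t : TLSVars} {v : RegVars}
    (hk : s.kind = .honest (.reg .client t v)) :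
    ∃ m, HasMsg M (s, 1) m ∧ Carries (M.serverSignature (t.session .client)) m := by
  simp only [hasMsg_iff_of_honest hk]
  cases M <;>
    simp [Instance.trace, Model.regFlow, Model.tlsFlow, TLSSession.flow12, TLSSession.flow13,
      Model.serverSignature, TLSSession.serverFlight12]

theorem hasMsg_challenge {side : Side} {t : TLSVars} {v : RegVars}
    (hk : s.kind = .honest (.reg side t v)) (hi : i + 2 = Role.serverReg.height M) :
    HasMsg M (s, i) (enc (name v.username ⋄ name v.appid ⋄ text v.challenge)
      (M.swk (t.session side))) := by
  rw [hasMsg_iff_of_honest hk]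
  cases M <;> simp [Role.height] at hi <;> subst hi <;> exact ⟨_, rfl⟩

theorem exists_hasMsg_regAssertion {side : Side} {t : TLSVars} {v : RegVars}
    (hk : s.kind = .honest (.reg side t v)) (hi : i + 1 = Role.serverReg.height M) :
    ∃ m, HasMsg M (s, i) m ∧ Carries (M.regAssertion (t.session side) v) m := by
  simp only [hasMsg_iff_of_honest hk]
  cases M <;> simp [Role.height] at hi <;> subst hi <;>
    simp [Instance.trace, Model.regFlow, Model.tlsFlow, TLSSession.flow12, TLSSession.flow13]

/-- A strand that has sent its Diffie-Hellman value uses its exponent. -/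
theorem exists_exptAppears_ownExp (hk : s.kind = .honest a) :
    ∃ i m, i ≤ 2 ∧ (a.side = .server → i ≤ 1) ∧ HasMsg M (s, i) m ∧ ExptAppears a.ownExp m := by
  simp only [hasMsg_iff_of_honest hk]
  cases M <;> rcases a with ⟨_ | _, t', v'⟩ | ⟨_ | _, t', v'⟩
  -- The own public value is in message 0 for a TLS 1.3 client, in message 1 for a server, and in
  -- message 2 for a TLS 1.2 client.
  all_goals first
    | (refine ⟨0, _, by simp, by simp, ⟨_, rfl⟩, ?_⟩
       simp [ExptAppears, TLSVars.session, Instance.ownExp]; done)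
    | (refine ⟨1, _, by simp, by simp, ⟨_, rfl⟩, ?_⟩
       simp [ExptAppears, TLSSession.serverFlight12, TLSVars.session, Instance.ownExp]; done)
    | (refine ⟨2, _, by simp, by simp [Instance.side], ⟨_, rfl⟩, ?_⟩
       simp [ExptAppears, TLSVars.session, Instance.ownExp])

end HonestStrands

/-! ## Injectivity -/

/-- Hashes are free constructors. Over TLS 1.2 the key depends on the exponents only through `g ^ (x
y)`, so nothing finer than `x + y` can be recovered in all models. -/
theorem Model.swk_inj {t t' : TLSSession} (h : M.swk t = M.swk t') :
    t.cr = t'.cr ∧ t.sr = t'.sr ∧ t.x + t.y = t'.x + t'.y := by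
  cases M <;> simp [Model.swk, TLSSession.swk12, TLSSession.swk13, TLSSession.masterSecret12,
    TLSSession.masterSecret13, TLSSession.sharedSecret, TLSSession.transcriptHash13,
    TLSSession.handshakeSecret13, TLSSession.hellos13] at h <;> grind

/-- The username is absent because the assertion does not contain it. -/
theorem Model.regAssertion_inj {t t' : TLSSession} {v v' : RegVars}
    (h : M.regAssertion t v = M.regAssertion t' v') :
    v.aaid = v'.aaid ∧ v.authk = v'.authk ∧ v.appid = v'.appid ∧ v.challenge = v'.challenge ∧
      M.tlsData t v.challenge = M.tlsData t' v.challenge := by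
  simp [Model.regAssertion, Model.finalChallenge] at h
  grind

/-- The channel binding and the server write key determine the session, together with the server's
exponent that a signature determines. -/
theorem Model.session_eq {t t' : TLSSession} {c : ℕ}
    (hd : M.tlsData t c = M.tlsData t' c) (hs : M.swk t = M.swk t')
    (hy : t.spk = t'.spk → t.y = t'.y) : t = t' := by
  obtain ⟨hcr, hsr, hxy⟩ := Model.swk_inj hs
  -- The certificate is inside the channel binding over TLS 1.2, and inside the transcript hash of
  -- the write key over TLS 1.3.
  obtain ⟨hserver, hspk, hca⟩ : t.server = t'.server ∧ t.spk = t'.spk ∧ t.ca = t'.ca := by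
    cases M <;> simp [Model.tlsData, Model.swk, TLSSession.swk13, TLSSession.transcriptHash13,
      TLSSession.certificate] at hd hs <;> grind
  rw [hy hspk] at hxy
  have hx := add_right_cancel hxy
  cases t
  cases t'
  simp_all

/-! ## Secrecy of the session keys -/

/-- Two secret exponents of different honest strands: no message of the bundle carries the
exponents, or a group element that depends on both of them. -/
theorem Bundle.secret_exponents (B : Bundle M) {s₁ s₂ : Strand} {a₁ a₂ : Instance} {a b : ℕ}
    (hab : a ≠ b) (h₁ : s₁.kind = .honest a₁) (h₂ : s₂.kind = .honest a₂)
    (ha : B.UniquelyGenerated a s₁) (hb : B.UniquelyGenerated b s₂) :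
    ∀ n ∈ B.nodes, ∀ m, HasMsg M n m →
      (∀ e, Carries (expt e) m → e a = 0 ∧ e b = 0) ∧
      (∀ e, Carries (gexp e) m → 0 ≤ e a ∧ 0 ≤ e b ∧ (e a = 0 ∨ e b = 0)) := by
  -- A strand that creates the exponent at node 0 would generate it there and thus be the honest
  -- generator, but honest strands never send exponents.
  have hcreate : ∀ {s₀ : Strand} {a₀ : Instance} {c : ℕ}, s₀.kind = .honest a₀ →
      B.UniquelyGenerated c s₀ → ∀ s, (s, 0) ∈ B.nodes → ¬ Sends M (s, 0) (expt (basicExpt c)) := by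
    rintro s₀ a₀ c h₀ ⟨n, -, rfl, -, hu⟩ s hs hsend
    have := hu (s, 0) hs ⟨⟨_, hsend, by simp [ExptAppears]⟩, by simp⟩
    rw [← this] at h₀
    exact not_carries_expt h₀ hsend _ .refl
  refine B.secrecy_induction ?_ ?_ ?_
  · intro s i j m hk _ hs
    refine ⟨fun e he => absurd he (not_carries_expt hk hs e), fun e he => ?_⟩
    rw [eq_of_carries_gexp hk hs he]
    by_cases h : i.ownExp = a
    · rw [h, basicExpt_apply_of_ne hab]
      simp
    · rw [basicExpt_apply_of_ne h]
      by_cases h' : i.ownExp = b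
      · simp [h']
      · simp [basicExpt_apply_of_ne h']
  · intro s m hs hsend hm
    refine ⟨fun e he => ?_, fun e he => ?_⟩
    · obtain rfl := hm.eq_of_carries he
      obtain ⟨c, rfl⟩ := hm
      refine ⟨basicExpt_apply_of_ne ?_, basicExpt_apply_of_ne ?_⟩ <;> rintro rfl
      exacts [hcreate h₁ ha s hs hsend, hcreate h₂ hb s hs hsend]
    · obtain rfl := hm.eq_of_carries he
      obtain rfl : e = 0 := hm
      simp
  -- Carried exponents vanish at `a` and `b`, and this survives products and inverses; so
  -- exponentiation leaves the coordinates of a group element at `a` and `b` unchanged.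
  · intro m hm
    have hm := hm.mono fun x hx => hx.1
    cases hm with
    | concat h h' => grind [carries_pair]
    | _ => simp_all

/-- The key is reached from the shared secret by nested hashes; no honest strand sends any of them,
and to compute one the penetrator needs its body. -/
theorem Bundle.nonOriginating_swk (B : Bundle M) {t : TLSSession}
    (h : B.NonOriginating (gexp (t.x + t.y))) : B.NonOriginating (M.swk t) := by
  have hash_tag : ∀ {c : Tag} {b : Msg},
      c = .masterSecret ∨ c = .handshakeSecret ∨ c = .serverWriteKey →
      B.NonOriginating b → B.NonOriginating (hash (tag c ⋄ b)) := fun hc hb =>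
    .hash hb.pair_right fun _ _ _ _ hk hs => not_carries_hash_tag hk hs hc _
  have h12 : B.NonOriginating t.swk12 :=
    hash_tag (by simp) (hash_tag (by simp) h.pair_left).pair_left
  have h13 : B.NonOriginating t.swk13 :=
    hash_tag (by simp) (hash_tag (by simp) (hash_tag (by simp) h)).pair_left
  cases M
  exacts [h12, h12, h13]

/-! ## The client of a complete server strand -/

theorem Model.serverSignature_eq (M : Model) (t : TLSSession) :
    ∃ b, M.serverSignature t = enc b (priv t.spk) := by
  cases M <;> exact ⟨_, rfl⟩

/-- The signature that a client receives comes from an honest server, if the server's key is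
secret. -/
theorem exists_signing_server (B : Bundle M) {s' : Strand} {t' : TLSVars} {v' : RegVars}
    (hk' : s'.kind = .honest (.reg .client t' v')) (hs' : (s', 1) ∈ B.nodes)
    (hkey : B.NonOriginating (priv t'.spk)) :
    ∃ s a, s.kind = .honest a ∧ (s, 1) ∈ B.nodes ∧ a.side = .server ∧ a.session.cr = t'.cr ∧
      a.session.sr = t'.sr ∧ a.session.y = t'.peerExp := by
  obtain ⟨m, hm, hc⟩ := exists_receives_serverSignature (M := M) hk'
  obtain ⟨b, hb⟩ := M.serverSignature_eq (t'.session .client)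
  obtain ⟨s, a, i, m', hk, hs, hsend, hc'⟩ :=
    B.exists_honest_sends_enc hkey hs' hm (hb ▸ hc)
  obtain ⟨hside, rfl, hcr, hsr, hy⟩ := eq_of_carries_serverSignature hk hsend (hb ▸ hc')
  exact ⟨s, a, hk, hs, hside, hcr, hsr, hy⟩

theorem Instance.session_y_of_server {a : Instance} (h : a.side = .server) :
    a.session.y = basicExpt a.ownExp := by
  rcases a with ⟨_ | _, _, _⟩ | ⟨_ | _, _, _⟩ <;> first | rfl | cases h

/-- Freshness only applies once the exponent is in use; the bounds on `k` guarantee that the public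
value is out. The weaker bound for servers is for a signer known only up to its signature. -/
theorem Bundle.FreshExponents.uniquelyGenerated {B : Bundle M} (hfresh : B.FreshExponents)
    {s : Strand} {a : Instance} (hk : s.kind = .honest a) {k : ℕ} (hs : (s, k) ∈ B.nodes)
    (h : 2 ≤ k ∨ (a.side = .server ∧ 1 ≤ k)) : B.UniquelyGenerated a.ownExp s := by
  obtain ⟨i, m, hi, hi', h'⟩ := exists_exptAppears_ownExp (M := M) hk
  refine hfresh s a hk ⟨i, m, B.mem_of_le ?_ hs, h'⟩
  rcases h with h | ⟨hside, h⟩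
  exacts [hi.trans h, (hi' hside).trans h]

theorem Bundle.UniquelyGenerated.strand_unique {B : Bundle M} {c : ℕ} {s s' : Strand}
    (h : B.UniquelyGenerated c s) (h' : B.UniquelyGenerated c s') : s = s' := by
  obtain ⟨n, -, rfl, -, hu⟩ := h
  obtain ⟨n', hn', rfl, hg, -⟩ := h'
  rw [hu n' hn' hg]

/-- The shared secret of a client is secret, if the client's channel binding is that of an honest
server whose key is secret. -/
theorem nonOriginating_sharedSecret (B : Bundle M) (hfresh : B.FreshExponents) {s s' : Strand}
    {t t' : TLSVars} {v v' : RegVars} (hk : s.kind = .honest (.reg .server t v))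
    (hk' : s'.kind = .honest (.reg .client t' v')) (hs : (s, 2) ∈ B.nodes) (hs' : (s', 2) ∈ B.nodes)
    (hkey : B.NonOriginating (priv t.spk)) {c : ℕ}
    (hdata : M.tlsData (t'.session .client) c = M.tlsData (t.session .server) c) :
    B.NonOriginating (t'.session .client).sharedSecret := by
  have hx : B.UniquelyGenerated t'.ownExp s' := hfresh.uniquelyGenerated hk' hs' (.inl le_rfl)
  -- The signer need not be `s`, but it is some honest server, so the shared exponent is the sum of
  -- two basic exponents generated on different strands.
  have of_spk (hspk : t'.spk = t.spk) :
      B.NonOriginating (t'.session .client).sharedSecret := by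
    obtain ⟨s₂, a₂, hk₂, hs₂, hside, -, -, hy₂⟩ :=
      exists_signing_server B hk' (B.mem_of_le one_le_two hs') (hspk ▸ hkey)
    have hy := hfresh.uniquelyGenerated hk₂ hs₂ (.inr ⟨hside, le_rfl⟩)
    have hne : t'.ownExp ≠ a₂.ownExp := fun heq => by
      have hss := Bundle.UniquelyGenerated.strand_unique hx (heq ▸ hy)
      rw [← hss, hk'] at hk₂
      cases hk₂
      cases hside
    rw [Instance.session_y_of_server hside] at hy₂
    intro n hn m hm hc
    have := (B.secret_exponents hne hk' hk₂ hx hy n hn m hm).2 _ hc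
    simp [TLSVars.session, ← hy₂, basicExpt_apply_of_ne hne,
      basicExpt_apply_of_ne hne.symm] at this
  cases M
  · refine of_spk ?_
    simp [Model.tlsData, TLSSession.certificate, TLSVars.session] at hdata
    exact hdata.1.2
  · refine of_spk ?_
    simp [Model.tlsData, TLSSession.certificate, TLSVars.session] at hdata
    exact hdata.1.2
  -- The exporter binding contains no certificate, but it equates the two shared secrets.
  · have hy : B.UniquelyGenerated t.ownExp s := hfresh.uniquelyGenerated hk hs (.inl le_rfl)
    have hne : t'.ownExp ≠ t.ownExp := fun heq => by
      have hss := Bundle.UniquelyGenerated.strand_unique hx (heq ▸ hy)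
      rw [← hss, hk'] at hk
      cases hk
    have hsum : basicExpt t'.ownExp + t'.peerExp = t.peerExp + basicExpt t.ownExp := by
      simp [Model.tlsData, TLSSession.masterSecret13, TLSSession.handshakeSecret13,
        TLSSession.sharedSecret, TLSVars.session] at hdata
      exact hdata.1
    have secret := B.secret_exponents hne hk' hk hx hy
    -- Received public values have nonnegative coordinates, so a peer cannot cancel the own
    -- exponent: by the two expressions of the shared exponent, its coordinates at both own
    -- exponents are at least 1.
    have hpeer' := (secret (s', 1) (B.mem_of_le one_le_two hs') _
      ((hasMsg_iff_of_honest hk').2 ⟨_, rfl⟩)).2 t'.peerExp (by simp [TLSVars.session])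
    have hpeer := (secret (s, 0) (B.mem_of_le zero_le_two hs) _
      ((hasMsg_iff_of_honest hk).2 ⟨_, rfl⟩)).2 t.peerExp (by simp [TLSVars.session])
    intro n hn m hm hc
    obtain ⟨-, -, h⟩ := (secret n hn m hm).2 (basicExpt t'.ownExp + t'.peerExp) hc
    have h1 : (basicExpt t'.ownExp + t'.peerExp) t'.ownExp = 1 + t'.peerExp t'.ownExp := by simp
    have h2 : (basicExpt t'.ownExp + t'.peerExp) t.ownExp = t.peerExp t.ownExp + 1 := by
      simp [hsum]
    omega

/-- Under the server's assumptions, the registration assertion comes from a client that has the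
same view of the session. -/
theorem exists_matching_client (B : Bundle M) (hfresh : B.FreshExponents) {s : Strand}
    {t : TLSVars} {v : RegVars} (hk : s.kind = .honest (.reg .server t v))
    (ho : ServerRegOrig M B s t v) {k : ℕ} (hM : Role.serverReg.height M = k + 2)
    (hs : (s, k + 1) ∈ B.nodes) :
    ∃ s' t', s'.kind = .honest (.reg .client t' v) ∧
      t'.session .client = t.session .server ∧ (s', k + 1) ∈ B.nodes := by
  have hk3 : 3 ≤ k := by
    cases M <;> simp [Role.height] at hM <;> omega
  -- the attestation
  obtain ⟨m, hm, hc⟩ := exists_hasMsg_regAssertion (M := M) hk (i := k + 1) (by omega)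
  obtain ⟨s', a', i, m', hk', hs', hsend', hc'⟩ :=
    B.exists_honest_sends_enc ho.attestation_key hs hm hc
  obtain ⟨t', v', rfl, hi, hass⟩ := eq_of_carries_regAssertion hk' hsend' hc'
  obtain rfl : i = k + 1 := by
    have : Role.clientReg.height M = k + 2 := hM
    omega
  obtain ⟨haaid, hauthk, happid, hchal, hdata⟩ := Model.regAssertion_inj hass
  -- the challenge under the client's secret key
  have hsecret := nonOriginating_sharedSecret B hfresh hk hk' (B.mem_of_le (by omega) hs)
    (B.mem_of_le (by omega) hs') ho.server_key hdata
  obtain ⟨s₃, a₃, i₃, m₃, hk₃, hs₃, hsend₃, hc₃⟩ :=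
    B.exists_honest_sends_enc (B.nonOriginating_swk hsecret) (B.mem_of_le k.le_succ hs')
      (hasMsg_challenge (M := M) hk' hM.symm) .refl
  obtain ⟨t₃, v₃, rfl, hi₃, huser, happ₃, hchal₃, hswk⟩ := eq_of_carries_challenge hk₃ hsend₃ hc₃
  obtain rfl : i₃ = k := by omega
  -- The challenge received by the client is the one in the assertion, and it originates only on
  -- `s`.
  obtain rfl : s₃ = s := by
    have horig := originates_challenge (M := M) hk₃ hM.symm
    rw [hchal₃, hchal] at horig
    obtain ⟨n, -, rfl, -, hu⟩ := ho.challenge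
    rw [← hu _ hs₃ horig]
  rw [hk] at hk₃
  cases hk₃
  have hsess : t'.session .client = t.session .server := by
    refine Model.session_eq hdata hswk.symm fun hspk => ?_
    obtain ⟨s₂, a₂, hk₂, hs₂, hside, hcr₂, hsr₂, hy₂⟩ :=
      exists_signing_server B hk' (B.mem_of_le (by omega) hs')
        ((show t'.spk = t.spk from hspk) ▸ ho.server_key)
    obtain ⟨hcr, hsr, -⟩ := Model.swk_inj hswk
    obtain ⟨n, -, hn, hg, hu⟩ := ho.server_random
    -- The signer has the same `cr` and `sr`; as these differ, `sr` originates on the signer too,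
    -- which must therefore be the given server.
    have hcrsr : (t.session .server).cr ≠ (t.session .server).sr :=
      cr_ne_sr_of_originates (M := M) (i := n.2) hk rfl (hn ▸ hg)
    have horig : Originates M (rand a₂.session.sr) (s₂, 1) :=
      originates_rand hk₂ hside (by
        rw [hcr₂, hsr₂]
        exact fun h => hcrsr (hcr.trans (h.trans hsr.symm)))
    obtain rfl : s₂ = s₃ := by
      rw [show a₂.session.sr = t.sr from hsr₂.trans hsr.symm] at horig
      rw [← hn, ← hu _ hs₂ horig]
    rw [hk] at hk₂
    cases hk₂
    exact hy₂.symm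
  refine ⟨s', t', ?_, hsess, hs'⟩
  rw [hk']
  cases v
  cases v'
  simp_all

/-! ## Uniqueness of the ideal execution -/

theorem agree_regContext {s s' : Strand} {t t' : TLSVars} {v v' : RegVars} {side side' : Side}
    (hk : s.kind = .honest (.reg side t v)) (hk' : s'.kind = .honest (.reg side' t' v')) :
    regContext.Agree s s' ↔ (t.session side).server = (t'.session side').server ∧
      (t.session side).ca = (t'.session side').ca ∧
      (t.session side).cr = (t'.session side').cr ∧
      (t.session side).sr = (t'.session side').sr ∧
      (t.session side).x = (t'.session side').x ∧
      (t.session side).y = (t'.session side').y ∧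
      v.challenge = v'.challenge ∧ v.username = v'.username ∧ v.appid = v'.appid := by
  simp [Context.Agree, regContext, tlsDHContext, Strand.value, hk, hk', TLSSession.value]
  grind

/-- Only registration strands have a username. -/
theorem exists_reg_of_agree {s u : Strand} (h : regContext.Agree s u) :
    ∃ side t v, u.kind = .honest (.reg side t v) := by
  obtain ⟨m, -, hm⟩ := h .username (by simp [regContext])
  rcases hu : u.kind with (⟨side, t, v⟩ | ⟨side, t, v⟩) | p
  · exact ⟨side, t, v, rfl⟩
  · simp [Strand.value, hu, TLSSession.value] at hm
  · simp [Strand.value, hu] at hm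

/-- Both sides run one and the same flow, and the side only decides the signs. -/
theorem trace_client_eq_flip {s s' : Strand} {t t' : TLSVars} {v : RegVars}
    (hk : s.kind = .honest (.reg .server t v)) (hk' : s'.kind = .honest (.reg .client t' v))
    (h : t'.session .client = t.session .server) :
    s'.trace M = (s.trace M).map fun e => (e.1.flip, e.2) := by
  simp only [Strand.trace, hk, hk', Instance.trace, h, List.map_map]
  refine List.map_congr_left fun e _ => ?_
  rcases e with ⟨_ | _, m⟩ <;> rfl

/-- Node `k` is the challenge message and node `k + 1` the assertion. -/
theorem exists_height_eq (M : Model) : ∃ k, 3 ≤ k ∧ ∀ R : Role, R.height M = k + 2 := by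
  cases M
  exacts [⟨4, by norm_num, fun _ => rfl⟩, ⟨4, by norm_num, fun _ => rfl⟩,
    ⟨3, by norm_num, fun _ => rfl⟩]

theorem Strand.length_trace_of_honest {s : Strand} {a : Instance} (hk : s.kind = .honest a) :
    (s.trace M).length = a.role.height M := by
  simp [Strand.trace, hk, Instance.length_trace]

/-- A rival server would originate the challenge a second time; a rival client has the same `x`,
which is its own exponent and is generated on one strand only. -/
theorem ideal_execution_unique (B : Bundle M) (hfresh : B.FreshExponents) (s : Strand)
    (ho : serverRegOrig M B s) (hH : Role.serverReg.height M ≤ B.height s) :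
    ∃ s' : Strand, IdealExecution M B s s' ∧
      ∀ (u : Strand) (R : Role), u.HasRole R → R.height M ≤ B.height u →
        regContext.Agree s u → u = s ∨ u = s' := by
  obtain ⟨t, v, hk, ho⟩ := ho
  obtain ⟨k, hk3, hM⟩ := exists_height_eq M
  rw [hM] at hH
  have hs : (s, k + 1) ∈ B.nodes := B.mem_of_lt_height (by omega)
  obtain ⟨s', t', hk', hsess, hs'⟩ := exists_matching_client B hfresh hk ho (hM _) hs
  have hheight : ∀ {u : Strand} {a : Instance}, u.kind = .honest a → (u, k + 1) ∈ B.nodes →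
      B.height u = k + 2 := fun hu hmem =>
    B.height_eq_of_mem (by rw [Strand.length_trace_of_honest hu, hM]) hmem
  have hagree : regContext.Agree s s' := by
    rw [agree_regContext hk hk', hsess]
    simp
  refine ⟨s', ⟨⟨_, hk, rfl⟩, ⟨_, hk', rfl⟩, ?_, ?_, hagree, trace_client_eq_flip hk hk' hsess⟩, ?_⟩
  · rw [hheight hk hs, hM]
  · rw [hheight hk' hs', hM]
  intro u R _ hu hsu
  rw [hM] at hu
  obtain ⟨side, t₁, v₁, hk₁⟩ := exists_reg_of_agree hsu
  have hu : (u, k + 1) ∈ B.nodes := B.mem_of_lt_height (by omega)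
  have hag := (agree_regContext hk hk₁).1 hsu
  cases side with
  | server =>
    left
    have horig := originates_challenge (M := M) hk₁ (hM .serverReg).symm
    rw [← hag.2.2.2.2.2.2.1] at horig
    obtain ⟨n, -, rfl, -, hun⟩ := ho.challenge
    rw [← hun _ (B.mem_of_le k.le_succ hu) horig]
  | client =>
    right
    have hx : basicExpt t'.ownExp = basicExpt t₁.ownExp := by
      have := hag.2.2.2.2.1
      rwa [← hsess] at this
    have hg' : B.UniquelyGenerated t'.ownExp s' :=
      hfresh.uniquelyGenerated hk' hs' (.inl (by omega))
    have hg₁ : B.UniquelyGenerated t₁.ownExp u :=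
      hfresh.uniquelyGenerated hk₁ hu (.inl (by omega))
    rw [← basicExpt_injective hx] at hg₁
    exact hg₁.strand_unique hg'

/-! ## Two strands that talk to each other -/

section Mirror

variable {s s' : Strand}

theorem getElem?_of_mirror (hm : s'.trace M = (s.trace M).map fun e => (e.1.flip, e.2))
    {i : ℕ} {g : Sign} {m : Msg} :
    (s'.trace M)[i]? = some (g, m) ↔ (s.trace M)[i]? = some (g.flip, m) := by
  rw [hm, List.getElem?_map]
  rcases (s.trace M)[i]? with _ | ⟨_ | _, m'⟩ <;> cases g <;> simp [Sign.flip]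

theorem mirror_symm (hm : s'.trace M = (s.trace M).map fun e => (e.1.flip, e.2)) :
    s.trace M = (s'.trace M).map fun e => (e.1.flip, e.2) := by
  rw [hm, List.map_map]
  conv_lhs => rw [← List.map_id (s.trace M)]
  refine List.map_congr_left fun e _ => ?_
  rcases e with ⟨_ | _, m⟩ <;> rfl

theorem receives_iff_sends_of_mirror
    (hm : s'.trace M = (s.trace M).map fun e => (e.1.flip, e.2)) {i : ℕ} {m : Msg} :
    Receives M (s', i) m ↔ Sends M (s, i) m :=
  getElem?_of_mirror hm

theorem not_sends_of_receives {n : Node} {m m' : Msg} (h : Receives M n m) : ¬ Sends M n m' := by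
  simp_all [Sends, Receives]

/-- The bundle of two complete strands that receive each other's messages. -/
def mirrorBundle (hne : s ≠ s') (hm : s'.trace M = (s.trace M).map fun e => (e.1.flip, e.2)) :
    Bundle M where
  nodes := {n | (n.1 = s ∨ n.1 = s') ∧ n.2 < (s.trace M).length}
  edge n n' := ((n.1 = s ∧ n'.1 = s') ∨ (n.1 = s' ∧ n'.1 = s)) ∧ n.2 = n'.2 ∧
    ∃ m, Sends M n m ∧ Receives M n' m
  finite := by
    refine (Set.Finite.prod (s := {s, s'}) (t := Set.Iio (s.trace M).length) (by simp)
      (Set.finite_Iio _)).subset ?_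
    rintro ⟨u, i⟩ h
    exact h
  valid := by
    rintro ⟨u, i⟩ ⟨rfl | rfl, hi⟩
    · exact hi
    · simpa [hm] using hi
  down_closed u i := fun ⟨hu, hi⟩ => ⟨hu, (Nat.lt_succ_self i).trans hi⟩
  edge_spec := by
    rintro ⟨u, i⟩ ⟨u', i'⟩ ⟨hu, hi, m, hs, hr⟩
    have hlen : (s'.trace M).length = (s.trace M).length := by simp [hm]
    obtain ⟨h1, -⟩ := List.getElem?_eq_some_iff.1 hs
    obtain ⟨h2, -⟩ := List.getElem?_eq_some_iff.1 hr
    rcases hu with ⟨rfl, rfl⟩ | ⟨rfl, rfl⟩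
    · exact ⟨⟨.inl rfl, h1⟩, ⟨.inr rfl, hlen ▸ h2⟩, hne, m, hs, hr⟩
    · exact ⟨⟨.inr rfl, hlen ▸ h1⟩, ⟨.inl rfl, h2⟩, hne.symm, m, hs, hr⟩
  recv_unique := by
    rintro ⟨u, i⟩ ⟨rfl | rfl, hi⟩ m hr
    · refine ⟨(s', i), ⟨.inr ⟨rfl, rfl⟩, rfl, m,
        (receives_iff_sends_of_mirror (mirror_symm hm)).1 hr, hr⟩, ?_⟩
      rintro ⟨u', j⟩ ⟨⟨-, h⟩ | ⟨h, -⟩, rfl, -⟩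
      exacts [absurd h hne, by rw [← h]]
    · refine ⟨(s, i), ⟨.inl ⟨rfl, rfl⟩, rfl, m,
        (receives_iff_sends_of_mirror hm).1 hr, hr⟩, ?_⟩
      rintro ⟨u', j⟩ ⟨⟨h, -⟩ | ⟨-, h⟩, rfl, -⟩
      exacts [by rw [← h], absurd h.symm hne]
  acyclic := by
    classical
    -- A send at position `i` has rank `2 * i` and its reception `2 * i + 1`, while the next
    -- position starts at `2 * i + 2`; so all steps increase the rank.
    let rank : Node → ℕ := fun n => 2 * n.2 + if ∃ m, Receives M n m then 1 else 0
    intro n hn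
    have : ∀ b, Relation.TransGen (fun a b : Node =>
        (((a.1 = s ∧ b.1 = s') ∨ (a.1 = s' ∧ b.1 = s)) ∧ a.2 = b.2 ∧
          ∃ m, Sends M a m ∧ Receives M b m) ∨
        (a ∈ {n : Node | (n.1 = s ∨ n.1 = s') ∧ n.2 < (s.trace M).length} ∧
          b ∈ {n : Node | (n.1 = s ∨ n.1 = s') ∧ n.2 < (s.trace M).length} ∧
          b.1 = a.1 ∧ b.2 = a.2 + 1)) n b → rank n < rank b := by
      have hstep : ∀ a b : Node, ((((a.1 = s ∧ b.1 = s') ∨ (a.1 = s' ∧ b.1 = s)) ∧ a.2 = b.2 ∧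
          ∃ m, Sends M a m ∧ Receives M b m) ∨
        (a ∈ {n : Node | (n.1 = s ∨ n.1 = s') ∧ n.2 < (s.trace M).length} ∧
          b ∈ {n : Node | (n.1 = s ∨ n.1 = s') ∧ n.2 < (s.trace M).length} ∧
          b.1 = a.1 ∧ b.2 = a.2 + 1)) → rank a < rank b := by
        rintro a b (⟨-, h2, m, hs, hr⟩ | ⟨-, -, -, h2⟩)
        · have ha : ¬ ∃ m, Receives M a m := fun ⟨_, h⟩ => not_sends_of_receives h hs
          have hb : ∃ m, Receives M b m := ⟨m, hr⟩
          simp [rank, ha, hb, h2]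
        · simp only [rank, h2]
          split_ifs <;> omega
      intro b hb
      induction hb with
      | single h => exact hstep _ _ h
      | tail _ h ih => exact ih.trans (hstep _ _ h)
    exact absurd (this n hn) (lt_irrefl _)

/-- A node whose message is the first one of the common trace with the property `P` is the only
node of the two strands at which `P` originates. -/
theorem firstSends_unique (hm : s'.trace M = (s.trace M).map fun e => (e.1.flip, e.2))
    {P : Msg → Prop} {k : ℕ} (hk : FirstSends M P (s, k)) {n : Node} (hn : n.1 = s ∨ n.1 = s')
    (hf : FirstSends M P n) : n = (s, k) := by
  -- The strands have equal messages at equal positions, so `P` first holds at the same position on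
  -- both, and only one of them sends there.
  have hhas : ∀ i m, HasMsg M (s, i) m ↔ HasMsg M (s', i) m := fun i m => by
    rw [HasMsg, HasMsg, receives_iff_sends_of_mirror hm,
      receives_iff_sends_of_mirror (mirror_symm hm), or_comm]
  obtain ⟨u, i⟩ := n
  obtain ⟨⟨m, hs, hP⟩, hlt⟩ := hk
  obtain ⟨⟨m', hs', hP'⟩, hlt'⟩ := hf
  have hu : ∀ j m, HasMsg M (u, j) m ↔ HasMsg M (s, j) m := by
    rcases hn with rfl | rfl
    exacts [fun _ _ => Iff.rfl, fun j m => (hhas j m).symm]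
  obtain rfl : i = k := by
    rcases lt_trichotomy i k with h | h | h
    · exact absurd hP' (hlt i h m' ((hu i m').1 (.inl hs')))
    · exact h
    · exact absurd hP (hlt' k h m ((hu k m).2 (.inl hs)))
  rcases hn with rfl | rfl
  · rfl
  · exact absurd hs' (not_sends_of_receives ((receives_iff_sends_of_mirror hm).2 hs))

end Mirror

/-! ## The ideal execution -/

/-- A sample registration. The username differs from the names that the server sends before it. -/
def sampleReg : RegVars where
  username := 3
  appid := 4
  aaid := 2
  challenge := 0
  authk := .other 1

/-- `cr` and `sr` differ so that `sr` originates on the server. The client's variables give the same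
session, with own and peer exponent exchanged. -/
noncomputable def sampleServerVars : TLSVars where
  server := 0
  ca := 1
  spk := .other 0
  cr := 0
  sr := 1
  ownExp := 1
  peerExp := basicExpt 0

noncomputable def sampleClientVars : TLSVars where
  server := 0
  ca := 1
  spk := .other 0
  cr := 0
  sr := 1
  ownExp := 0
  peerExp := basicExpt 1

noncomputable def sampleServer : Strand :=
  ⟨0, .honest (.reg .server sampleServerVars sampleReg)⟩

noncomputable def sampleClient : Strand :=
  ⟨0, .honest (.reg .client sampleClientVars sampleReg)⟩

theorem sampleServer_ne_sampleClient : sampleServer ≠ sampleClient := by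
  simp [sampleServer, sampleClient]

theorem sample_mirror (M : Model) :
    sampleClient.trace M = (sampleServer.trace M).map fun e => (e.1.flip, e.2) :=
  trace_client_eq_flip rfl rfl rfl

/-- The ideal execution of a server and a client, with no further strands. -/
noncomputable def sampleBundle (M : Model) : Bundle M :=
  mirrorBundle sampleServer_ne_sampleClient (sample_mirror M)

theorem sample_firstSends {P : Msg → Prop} {s : Strand}
    (hs : s = sampleServer ∨ s = sampleClient) {k : ℕ} (hk : FirstSends M P (s, k)) :
    ∃ n ∈ (sampleBundle M).nodes, n.1 = s ∧ FirstSends M P n ∧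
      ∀ n' ∈ (sampleBundle M).nodes, FirstSends M P n' → n' = n := by
  have hlen : (sampleServer.trace M).length = (s.trace M).length := by
    rcases hs with rfl | rfl <;> simp [sample_mirror M]
  refine ⟨(s, k), ⟨hs, ?_⟩, rfl, hk, fun n' hn' hf => ?_⟩
  · obtain ⟨⟨m, hm, -⟩, -⟩ := hk
    rw [hlen]
    exact (List.getElem?_eq_some_iff.1 hm).1
  · rcases hs with rfl | rfl
    · exact firstSends_unique (sample_mirror M) hk hn'.1 hf
    · exact firstSends_unique (mirror_symm (sample_mirror M)) hk hn'.1.symm hf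

/-- Private keys occur only as signing keys and under a hash, neither of which is a carried
position. -/
theorem sample_nonOriginating_priv (M : Model) (p : KeyPair) :
    (sampleBundle M).NonOriginating (priv p) := by
  have key : ∀ i m, HasMsg M (sampleServer, i) m → ¬ Carries (priv p) m := by
    intro i m hm
    obtain ⟨g, hg⟩ := (hasMsg_iff_of_honest rfl).1 hm
    cases M <;> rcases i with _ | _ | _ | _ | _ | _ | i <;>
      simp [Instance.trace, Model.regFlow, Model.tlsFlow, TLSSession.flow12,
        TLSSession.flow13, Side.sign] at hg <;>
      obtain ⟨-, rfl⟩ := hg <;>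
      simp [Model.regAssertion, Model.finalChallenge, TLSSession.serverFlight12,
        TLSSession.certificate, TLSSession.clientFinished12, TLSSession.serverFinished12,
        TLSSession.certificateVerify13, TLSSession.serverFinished13, TLSSession.clientFinished13]
  rintro ⟨u, i⟩ ⟨rfl | rfl, -⟩ m hm
  · exact key i m hm
  · refine key i m ?_
    rw [HasMsg, receives_iff_sends_of_mirror (sample_mirror M)] at hm
    rw [HasMsg, receives_iff_sends_of_mirror (mirror_symm (sample_mirror M))]
    exact hm.symm

theorem sample_username (M : Model) : ∃ k, FirstSends M (Carries (name 3)) (sampleServer, k) := by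
  obtain ⟨k, -, hM⟩ := exists_height_eq M
  have hM := hM .serverReg
  refine ⟨k, firstSends_of_honest (a := .reg .server sampleServerVars sampleReg)
    (m := enc (name 3 ⋄ name 4 ⋄ text 0) (M.swk (sampleServerVars.session .server))) rfl ?_
    (by simp) fun j hj e he => ?_⟩
  · cases M <;> simp [Role.height] at hM <;> subst hM <;> rfl
  · cases M <;> simp [Role.height] at hM <;> subst hM <;> interval_cases j <;>
      simp [Instance.trace, Model.regFlow, Model.tlsFlow, TLSSession.flow12,
        TLSSession.flow13, Side.sign] at he <;>
      subst he <;>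
      simp [TLSSession.serverFlight12, TLSSession.certificate, TLSSession.clientFinished12,
        TLSSession.serverFinished12, TLSSession.certificateVerify13, TLSSession.serverFinished13,
        TLSSession.clientFinished13, TLSVars.session, sampleServerVars]

theorem sample_server_exponent (M : Model) :
    FirstSends M (ExptAppears 1) (sampleServer, 1) := by
  have h1 : ∃ m, Sends M (sampleServer, 1) m ∧ ExptAppears 1 m := by
    cases M
    · exact ⟨_, rfl, by simp [ExptAppears, TLSSession.serverFlight12, TLSVars.session, sampleServerVars]⟩
    · exact ⟨_, rfl, by simp [ExptAppears, TLSSession.serverFlight12, TLSVars.session, sampleServerVars]⟩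
    · exact ⟨_, rfl, by simp [ExptAppears, TLSVars.session, sampleServerVars]⟩
  obtain ⟨m, hs, hP⟩ := h1
  refine firstSends_of_honest rfl ((sends_iff_of_honest rfl).1 hs) hP fun j hj e he => ?_
  obtain rfl : j = 0 := by omega
  cases M <;>
    simp [Instance.trace, Model.regFlow, Model.tlsFlow, TLSSession.flow12,
      TLSSession.flow13, Side.sign] at he <;>
    subst he <;>
    simp [ExptAppears, TLSVars.session, sampleServerVars, basicExpt_apply_of_ne]

theorem sample_client_exponent (M : Model) :
    ∃ k, FirstSends M (ExptAppears 0) (sampleClient, k) := by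
  have h : ∃ (k : ℕ) (m : Msg), (Instance.trace M (.reg .client sampleClientVars sampleReg))[k]? =
      some (Sign.send, m) ∧ ExptAppears 0 m ∧ ∀ j < k, ∀ e : Sign × Msg,
        (Instance.trace M (.reg .client sampleClientVars sampleReg))[j]? = some e →
          ¬ ExptAppears 0 e.2 := by
    cases M
    case exporterTLS13 =>
      exact ⟨0, _, rfl, by simp [ExptAppears, TLSVars.session, sampleClientVars], by simp⟩
    all_goals
      refine ⟨2, _, rfl, by simp [ExptAppears, TLSVars.session, sampleClientVars],
        fun j hj e he => ?_⟩
      interval_cases j <;>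
        simp [Instance.trace, Model.regFlow, Model.tlsFlow, TLSSession.flow12] at he <;>
        subst he <;>
        simp [ExptAppears, TLSSession.serverFlight12, TLSSession.certificate,
          TLSVars.session, sampleClientVars, basicExpt_apply_of_ne]
  obtain ⟨k, m, hm, hP, hlt⟩ := h
  exact ⟨k, firstSends_of_honest rfl hm hP hlt⟩

theorem sample_orig (M : Model) : serverRegOrig M (sampleBundle M) sampleServer := by
  obtain ⟨k, -, hM⟩ := exists_height_eq M
  obtain ⟨ku, hu⟩ := sample_username M
  refine ⟨_, _, rfl, ?_⟩
  refine ⟨sample_nonOriginating_priv M _, sample_nonOriginating_priv M _,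
    sample_nonOriginating_priv M _, sample_nonOriginating_priv M _, ?_, ?_, ?_, ?_⟩
  · exact sample_firstSends (.inl rfl) (originates_rand (M := M) (s := sampleServer)
      (a := .reg .server sampleServerVars sampleReg) rfl rfl
      (by simp [Instance.session, Instance.tls, Instance.side, TLSVars.session, sampleServerVars]))
  · exact sample_firstSends (.inl rfl) (sample_server_exponent M)
  · exact sample_firstSends (.inl rfl) (originates_challenge (M := M) (s := sampleServer)
      (v := sampleReg) rfl (hM .serverReg).symm)
  · exact sample_firstSends (.inl rfl) hu

theorem sample_fresh (M : Model) : (sampleBundle M).FreshExponents := by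
  rintro s a hk ⟨i, m, ⟨rfl | rfl, -⟩, -⟩
  · cases hk
    exact sample_firstSends (.inl rfl) (sample_server_exponent M)
  · cases hk
    obtain ⟨k, hx⟩ := sample_client_exponent M
    exact sample_firstSends (.inr rfl) hx

theorem sample_height (M : Model) {s : Strand} (hs : s = sampleServer ∨ s = sampleClient)
    (R : Role) : (sampleBundle M).height s = R.height M := by
  obtain ⟨k, -, hM⟩ := exists_height_eq M
  have hlen : (sampleServer.trace M).length = k + 2 :=
    (Strand.length_trace_of_honest rfl).trans (hM _)
  rw [hM]
  refine (sampleBundle M).height_eq_of_mem ?_ ⟨hs, by rw [hlen]; exact Nat.lt_succ_self _⟩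
  rcases hs with rfl | rfl
  exacts [hlen, by rw [sample_mirror M, List.length_map, hlen]]

theorem sample_ideal (M : Model) :
    IdealExecution M (sampleBundle M) sampleServer sampleClient where
  server_role := ⟨_, rfl, rfl⟩
  client_role := ⟨_, rfl, rfl⟩
  server_complete := sample_height M (.inl rfl) _
  client_complete := sample_height M (.inr rfl) _
  agree := (agree_regContext rfl rfl).2
    (by simp [TLSVars.session, sampleServerVars, sampleClientVars])
  mirror := sample_mirror M

/-! ## Session context agreement -/

theorem Strand.HasRole.unique {s : Strand} {R R' : Role} (h : s.HasRole R) (h' : s.HasRole R') :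
    R = R' := by
  obtain ⟨a, hk, rfl⟩ := h
  obtain ⟨a', hk', rfl⟩ := h'
  rw [hk] at hk'
  cases hk'
  rfl

/-- In the sample bundle the only strand complementary to the server is the client, whatever `j` is.
-/
theorem uniq_serverReg (M : Model) (j : ℕ) :
    Uniq M .serverReg regContext (serverRegOrig M) (Role.serverReg.height M) j := by
  have key : ∀ R, Succ M .serverReg R regContext (serverRegOrig M) (Role.serverReg.height M) j →
      R = .clientReg := by
    intro R h
    obtain ⟨s', hR, ⟨i, hi⟩, ⟨R₁, R₂, h₁, h₂, hc⟩, -⟩ := h (sampleBundle M) (sample_fresh M)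
      sampleServer ⟨_, rfl, rfl⟩
      ⟨0, .inl rfl, by rw [Strand.length_trace_of_honest rfl]; cases M <;> simp [Role.height]⟩
      (sample_orig M) (sample_height M (.inl rfl) _).ge
    rcases hi.1 with h | h
    · obtain rfl : s' = sampleServer := h
      rw [h₁.unique h₂] at hc
      rcases hc with ⟨h, h'⟩ | ⟨h, h'⟩ <;> simp [h] at h'
    · obtain rfl : s' = sampleClient := h
      exact hR.unique ⟨_, rfl, rfl⟩
  exact fun Rb Rc ⟨hb, hc⟩ => (key Rb hb).trans (key Rc hc).symm

end UAF

/-! ### The theorem. -/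

theorem theorem3 (M : UAF.Model) :
    UAF.SessionContextAgreement M UAF.Role.serverReg UAF.Role.clientReg UAF.regContext
        (UAF.serverRegOrig M) ∧
      UAF.UniqueIdealShape M := by
  -- The client's guaranteed height `j` is the full height of its role.
  refine ⟨⟨_, le_rfl, ?_, UAF.uniq_serverReg M _⟩, ?_, ?_⟩
  · intro B hfresh s hrole _ ho hH
    obtain ⟨s', hs', -⟩ := UAF.ideal_execution_unique B hfresh s ho hH
    refine ⟨s', hs'.client_role, ?_, ?_, hs'.client_complete.ge, hs'.agree⟩
    · refine ⟨0, B.mem_of_lt_height ?_⟩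
      rw [hs'.client_complete]
      cases M <;> simp [UAF.Role.height]
    · exact ⟨_, _, hs'.server_role, hs'.client_role, .inr ⟨rfl, rfl⟩⟩
  · exact ⟨UAF.sampleBundle M, _, _, UAF.sample_fresh M, UAF.sample_orig M, UAF.sample_ideal M,
      fun n hn => hn.1⟩
  · exact fun B hfresh s _ ho hH => UAF.ideal_execution_unique B hfresh s ho hH
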